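/- Conventions. All manifolds and maps are smooth. For a manifold $X$, $TX\oplus T^*X$ carries the pairing $\langle v+\xi,w+\eta\rangle=\tfrac12(\xi(w)+\eta(v))$. A generalized complex structure on $X$ is a smooth endomorphism field $\mathcal J$ of $TX\oplus T^*X$ that preserves $\langle\,,\rangle$, satisfies $\mathcal J^2=-\mathrm{id}$, and whose $(-\sqrt{-1})$-eigenbundle $L_{\mathcal J}\subset (TX\oplus T^*X)^{\mathbb C}$ is involutive for the Courant bracket. A generalized Kähler structure is a pair $(\mathcal J_0,\mathcal J_1)$ of commuting generalized complex structures such that $\langle-\mathcal J_0\mathcal J_1E,E\rangle>0$ for all $E\neq0$. A pure spinor on $X$ is a nowhere vanishing smooth complex differential form $\psi$ (of mixed degree) such that $\ker\psi_x=\{E\in(T_xX\oplus T_x^*X)^{\mathbb C} : E\cdot\psi_x=0\}$ has complex dimension $\dim_{\mathbb R}X$ at every point $x$, where $(v+\xi)\cdot\psi=\iota_v\psi+\xi\wedge\psi$; it is non-degenerate if $(TX\oplus T^*X)^{\mathbb C}=\ker\psi\oplus\overline{\ker\psi}$, and then $\mathcal J_\psi$ denotes the endomorphism field with $(-\sqrt{-1})$-eigenbundle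 $\ker\psi$. A generalized Kähler structure with one pure spinor is a pair $(\mathcal J_0,\psi)$ of a generalized complex structure and a $d$-closed, non-degenerate pure spinor such that $(\mathcal J_0,\mathcal J_\psi)$ is a generalized Kähler structure. Theorem. Let $X$ be a manifold with a generalized Kähler structure with one pure spinor $(\mathcal J_0,\psi)$, and let $i_M:M\to X$ be an (immersed) submanifold whose conormal bundle $N^*=\ker(i_M^*:T^*X|_M\to T^*M)$ satisfies $\mathcal J_0(N^*)=N^*$. Then: 1. the pullback $i_M^*\psi$ is nowhere vanishing, and it is a $d$-closed, non-degenerate pure spinor on $M$; 2. there is exactly one endomorphism field $\mathcal J_{0,M}$ of $TM\oplus T^*M$ whose $(-\sqrt{-1})$-eigenbundle is the image of $L_{\mathcal J_0}\cap(TM\oplus T^*X|_M)^{\mathbb C}$ under the map $\mathrm{id}_{TM}\oplus i_M^*:(TM\oplus T^*X|_M)^{\mathbb C}\to(TM\oplus T^*M)^{\mathbb C}$; 3. the pair $(\mathcal J_{0,M},i_M^*\psi)$ is a generalized Kähler structure with one pure spinor on $M$. -/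

import Mathlib

open scoped Manifold ContDiff TensorProduct

noncomputable section

namespace GenKaehler

/-! ### Linear algebra of `V ⊕ V*` and its complexification -/

section Linear

/-- `V ⊕ V*`. -/
abbrev GT (V : Type*) [AddCommGroup V] [Module ℝ V] [TopologicalSpace V] : Type _ :=
  V × (V →L[ℝ] ℝ)

variable {V W : Type*}
  [AddCommGroup V] [Module ℝ V] [TopologicalSpace V]
  [AddCommGroup W] [Module ℝ W] [TopologicalSpace W]

/-- The natural symmetric pairing `⟨v + ξ, w + η⟩ = (ξ(w) + η(v)) / 2` on `V ⊕ V*`. -/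
def pairing (A B : GT V) : ℝ := (A.2 B.1 + B.2 A.1) / 2

/-- The vector `a + i b` of the complexification of a real vector space `U`. -/
def cx {U : Type*} [AddCommGroup U] [Module ℝ U] (a b : U) : ℂ ⊗[ℝ] U :=
  (1 : ℂ) ⊗ₜ[ℝ] a + Complex.I ⊗ₜ[ℝ] b

/-- Complex conjugation on the complexification of a real vector space. -/
def conj (U : Type*) [AddCommGroup U] [Module ℝ U] : ℂ ⊗[ℝ] U →ₗ[ℝ] ℂ ⊗[ℝ] U :=
  LinearMap.rTensor U Complex.conjAe.toLinearMap

theorem conj_smul {U : Type*} [AddCommGroup U] [Module ℝ U] (c : ℂ) (x : ℂ ⊗[ℝ] U) :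
    conj U (c • x) = (starRingEnd ℂ c) • conj U x := by
  induction x using TensorProduct.induction_on with
  | zero => simp
  | tmul a b => simp [conj, TensorProduct.smul_tmul']
  | add x y hx hy => rw [smul_add, map_add, hx, hy, map_add, smul_add]

/-- The complex conjugate of a complex subspace of a complexification (as conjugation is an
involution, its image is its preimage). -/
def conjSubmodule {U : Type*} [AddCommGroup U] [Module ℝ U] (L : Submodule ℂ (ℂ ⊗[ℝ] U)) :
    Submodule ℂ (ℂ ⊗[ℝ] U) where
  carrier := {x | conj U x ∈ L}
  add_mem' := by
    intro a b ha hb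
    simpa using L.add_mem ha hb
  zero_mem' := by simp
  smul_mem' := by
    intro c x hx
    simpa [conj_smul] using L.smul_mem (starRingEnd ℂ c) hx

/-- The `(-i)`-eigenspace `L_J` of the complexification of a real endomorphism `J`. -/
def eigenL {U : Type*} [AddCommGroup U] [Module ℝ U] (J : U →ₗ[ℝ] U) :
    Submodule ℂ (ℂ ⊗[ℝ] U) :=
  Module.End.eigenspace (J.baseChange ℂ) (-Complex.I)

/-- Complex valued exterior forms of mixed degree on `V`; the entry `φ k` is the part of
degree `k` (it vanishes as soon as `k > dim V`, so that this is the direct sum of the spaces of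
`k`-forms when `V` is finite dimensional). -/
abbrev MixedForm (V : Type*) [AddCommGroup V] [Module ℝ V] : Type _ :=
  (k : ℕ) → V [⋀^Fin k]→ₗ[ℝ] ℂ

/-- The wedge product `ξ ∧ φ` of a real covector and a `k`-form,
`(ξ ∧ φ)(v₀, …, v_k) = ∑ᵢ (-1)ⁱ ξ(vᵢ) φ(v₀, …, v̂ᵢ, …, v_k)`. -/
def covectorWedge {k : ℕ} (ξ : V →L[ℝ] ℝ) (φ : V [⋀^Fin k]→ₗ[ℝ] ℂ) :
    V [⋀^Fin (k + 1)]→ₗ[ℝ] ℂ :=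
  AlternatingMap.alternatizeUncurryFin ((ξ : V →ₗ[ℝ] ℝ).smulRight φ)

/-- The Clifford action `(v + ξ) · φ = ι_v φ + ξ ∧ φ`. -/
def cliffordFun (A : GT V) (φ : MixedForm V) : MixedForm V
  | 0 => (φ 1).curryLeft A.1
  | k + 1 => (φ (k + 2)).curryLeft A.1 + covectorWedge A.2 (φ k)

/-- The Clifford action on a fixed form, as a real linear map in the element of `V ⊕ V*`. -/
def clifford (φ : MixedForm V) : GT V →ₗ[ℝ] MixedForm V where
  toFun A := cliffordFun A φ
  map_add' := by
    intro A B
    funext k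
    cases k with
    | zero => simp [cliffordFun]
    | succ k =>
      ext v
      simp [cliffordFun, covectorWedge, AlternatingMap.alternatizeUncurryFin_apply, add_smul,
        Finset.sum_add_distrib]
      ring
  map_smul' := by
    intro c A
    funext k
    cases k with
    | zero => simp [cliffordFun]
    | succ k =>
      ext v
      simp [cliffordFun, covectorWedge, AlternatingMap.alternatizeUncurryFin_apply,
        Finset.mul_sum]
      refine Finset.sum_congr rfl fun i _ => ?_
      ring

/-- `ker φ = {E ∈ (V ⊕ V*) ⊗ ℂ | E · φ = 0}`, for the complex linear extension of the Clifford
action. -/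
def spinorKer (φ : MixedForm V) : Submodule ℂ (ℂ ⊗[ℝ] GT V) :=
  LinearMap.ker ((clifford φ).liftBaseChange ℂ)

/-- Pure spinors: nonzero forms whose kernel has complex dimension `dim V`. -/
def IsPureSpinor (φ : MixedForm V) : Prop :=
  φ ≠ 0 ∧ Module.finrank ℂ (spinorKer φ) = Module.finrank ℝ V

/-- Non-degeneracy: `(V ⊕ V*) ⊗ ℂ` is the direct sum of `ker φ` and its complex conjugate. -/
def IsNondegenerateSpinor (φ : MixedForm V) : Prop :=
  IsCompl (spinorKer φ) (conjSubmodule (spinorKer φ))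

/-- For a linear map `f : V → W` (an inclusion of a subspace), the linear map
`V ⊕ W* → W ⊕ W*`, `(v, η) ↦ (f v, η)`, whose image is the preimage of `f(V)` under
`W ⊕ W* → W`. -/
def includeGT (f : V →L[ℝ] W) : (V × (W →L[ℝ] ℝ)) →ₗ[ℝ] GT W :=
  LinearMap.prodMap (f : V →ₗ[ℝ] W) LinearMap.id

/-- The map `p : V ⊕ W* → V ⊕ V*`, `(v, η) ↦ (v, f* η)`. -/
def restrictGT (f : V →L[ℝ] W) [ContinuousAdd V] [ContinuousConstSMul ℝ V] :
    (V × (W →L[ℝ] ℝ)) →ₗ[ℝ] GT V where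
  toFun a := (a.1, a.2.comp f)
  map_add' := by intro a b; simp
  map_smul' := by intro c a; simp

/-- The conormal space `N* = {(0, η) | f* η = 0} ⊆ W ⊕ W*`. -/
def conormal (f : V →L[ℝ] W) : Submodule ℝ (GT W) where
  carrier := {A | A.1 = 0 ∧ A.2.comp f = 0}
  add_mem' := by
    rintro a b ⟨h1, h2⟩ ⟨h3, h4⟩
    exact ⟨by simp [h1, h3], by simp [h2, h4]⟩
  zero_mem' := by simp
  smul_mem' := by
    rintro c a ⟨h1, h2⟩
    exact ⟨by simp [h1], by simp [h2]⟩

/-- For a complex subspace `L ⊆ (W ⊕ W*) ⊗ ℂ`, the subspace `p(L ∩ (V ⊕ W*) ⊗ ℂ)` of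
`(V ⊕ V*) ⊗ ℂ`. -/
def restrictSubspace (f : V →L[ℝ] W) [ContinuousAdd V] [ContinuousConstSMul ℝ V]
    (L : Submodule ℂ (ℂ ⊗[ℝ] GT W)) : Submodule ℂ (ℂ ⊗[ℝ] GT V) :=
  (L.comap ((includeGT f).baseChange ℂ)).map ((restrictGT f).baseChange ℂ)

end Linear

/-! ### The Courant bracket on a normed space -/

section Flat

variable {E : Type*} [NormedAddCommGroup E] [NormedSpace ℝ E]

/-- `ι_u dη`, that is `w ↦ (D_u η)(w) - (D_w η)(u)`. -/
def contractD (u : E → E) (η : E → E →L[ℝ] ℝ) (y : E) : E →L[ℝ] ℝ :=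
  fderiv ℝ η y (u y) - (fderiv ℝ η y).flip (u y)

/-- The Lie derivative `𝓛_u η = ι_u dη + d(ι_u η)` of a one-form. -/
def lieDerivForm (u : E → E) (η : E → E →L[ℝ] ℝ) (y : E) : E →L[ℝ] ℝ :=
  contractD u η y + fderiv ℝ (fun z => η z (u z)) y

/-- The Courant bracket
`[u + ξ, v + η] = [u, v] + (𝓛_u η - 𝓛_v ξ - ι_v dξ + ι_u dη) / 2`. -/
def courant (A B : E → GT E) (y : E) : GT E :=
  (VectorField.lieBracket ℝ (fun z => (A z).1) (fun z => (B z).1) y,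
    (1 / 2 : ℝ) • (lieDerivForm (fun z => (A z).1) (fun z => (B z).2) y
      - lieDerivForm (fun z => (B z).1) (fun z => (A z).2) y
      - contractD (fun z => (B z).1) (fun z => (A z).2) y
      + contractD (fun z => (A z).1) (fun z => (B z).2) y))

/-- A field `L` of complex subspaces of `(E ⊕ E*) ⊗ ℂ` is involutive on an open set `S`: the
complex bilinear extension of the Courant bracket of two local smooth sections
`A₁ + i B₁`, `A₂ + i B₂` of `L` is a section of `L`. -/
def IsInvolutiveOn (L : E → Submodule ℂ (ℂ ⊗[ℝ] GT E)) (S : Set E) : Prop :=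
  ∀ U : Set E, IsOpen U → U ⊆ S → ∀ A₁ B₁ A₂ B₂ : E → GT E,
    ContDiffOn ℝ ∞ A₁ U → ContDiffOn ℝ ∞ B₁ U → ContDiffOn ℝ ∞ A₂ U → ContDiffOn ℝ ∞ B₂ U →
    (∀ y ∈ U, cx (A₁ y) (B₁ y) ∈ L y) → (∀ y ∈ U, cx (A₂ y) (B₂ y) ∈ L y) →
    ∀ y ∈ U, cx (courant A₁ A₂ y - courant B₁ B₂ y) (courant A₁ B₂ y + courant B₁ A₂ y) ∈ L y

end Flat

/-! ### Generalized complex and generalized Kähler structures on manifolds -/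

section Manifold

variable {E : Type*} [NormedAddCommGroup E] [NormedSpace ℝ E]
  {X : Type*} [TopologicalSpace X] [ChartedSpace E X]

/-- A (rough) field of endomorphisms of `TX ⊕ T*X`. -/
abbrev EndField (E : Type*) [NormedAddCommGroup E] [NormedSpace ℝ E]
    (X : Type*) [TopologicalSpace X] [ChartedSpace E X] : Type _ :=
  (x : X) → GT (TangentSpace 𝓘(ℝ, E) x) →L[ℝ] GT (TangentSpace 𝓘(ℝ, E) x)

/-- A (rough) complex differential form of mixed degree on `X`. -/
abbrev FormField (E : Type*) [NormedAddCommGroup E] [NormedSpace ℝ E]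
    (X : Type*) [TopologicalSpace X] [ChartedSpace E X] : Type _ :=
  (x : X) → (k : ℕ) → (TangentSpace 𝓘(ℝ, E) x) [⋀^Fin k]→L[ℝ] ℂ

/-- The value of a form at a point, as an exterior form on the tangent space. -/
def FormField.at (ψ : FormField E X) (x : X) : MixedForm (TangentSpace 𝓘(ℝ, E) x) :=
  fun k => (ψ x k).toAlternatingMap

/-- The differential `T_xX → E` of a chart. -/
def chartDeriv (e : OpenPartialHomeomorph X E) (x : X) : TangentSpace 𝓘(ℝ, E) x →L[ℝ] E :=
  (NormedSpace.fromTangentSpace (e x)).toContinuousLinearMap.comp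
    (mfderiv 𝓘(ℝ, E) 𝓘(ℝ, E) e x)

/-- The differential `E → T_xX`, `x = e⁻¹(y)`, of the inverse of a chart. -/
def chartSymmDeriv (e : OpenPartialHomeomorph X E) (y : E) :
    E →L[ℝ] TangentSpace 𝓘(ℝ, E) (e.symm y) :=
  (mfderiv 𝓘(ℝ, E) 𝓘(ℝ, E) e.symm y).comp
    (NormedSpace.fromTangentSpace y).symm.toContinuousLinearMap

/-- The isomorphism `(v, ξ) ↦ (De⁻¹ v, ξ ∘ De)` from `E ⊕ E*` to `T_xX ⊕ T_x*X`, `x = e⁻¹(y)`. -/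
def fromChart (e : OpenPartialHomeomorph X E) (y : E) :
    GT E →L[ℝ] GT (TangentSpace 𝓘(ℝ, E) (e.symm y)) :=
  (chartSymmDeriv e y).prodMap
    (ContinuousLinearMap.precomp ℝ (chartDeriv e (e.symm y)))

/-- The isomorphism `(w, θ) ↦ (De w, θ ∘ De⁻¹)` from `T_xX ⊕ T_x*X`, `x = e⁻¹(y)`, to
`E ⊕ E*`. -/
def toChart (e : OpenPartialHomeomorph X E) (y : E) :
    GT (TangentSpace 𝓘(ℝ, E) (e.symm y)) →L[ℝ] GT E :=
  (chartDeriv e (e.symm y)).prodMap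
    (ContinuousLinearMap.precomp ℝ (chartSymmDeriv e y))

/-- The coordinate expression of an endomorphism field in a chart. -/
def EndField.inChart (J : EndField E X) (e : OpenPartialHomeomorph X E) (y : E) :
    GT E →L[ℝ] GT E :=
  (toChart e y).comp ((J (e.symm y)).comp (fromChart e y))

/-- The coordinate expression of the degree `k` part of a form in a chart. -/
def FormField.inChart (ψ : FormField E X) (e : OpenPartialHomeomorph X E) (k : ℕ) (y : E) :
    E [⋀^Fin k]→L[ℝ] ℂ :=
  (ψ (e.symm y) k).compContinuousLinearMap (chartSymmDeriv e y)

def EndField.IsSmooth (J : EndField E X) : Prop :=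
  ∀ e ∈ atlas E X, ContDiffOn ℝ ∞ (J.inChart e) e.target

def FormField.IsSmooth (ψ : FormField E X) : Prop :=
  ∀ e ∈ atlas E X, ∀ k, ContDiffOn ℝ ∞ (ψ.inChart e k) e.target

/-- `dψ = 0`. -/
def FormField.IsClosed (ψ : FormField E X) : Prop :=
  ∀ e ∈ atlas E X, ∀ k, ∀ y ∈ e.target, extDeriv (ψ.inChart e k) y = 0

/-- Almost generalized complex structures: smooth orthogonal endomorphism fields of `TX ⊕ T*X`
with square `-id` (such an endomorphism has determinant one, as its complex eigenvalues
`i`, `-i` have the same multiplicity). -/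
structure IsAlmostGenComplex (J : EndField E X) : Prop where
  smooth : J.IsSmooth
  sq : ∀ x A, J x (J x A) = -A
  orthogonal : ∀ x A B, pairing (J x A) (J x B) = pairing A B

/-- Generalized complex structures: the eigenbundle `L_J` is involutive for the Courant bracket.
The Courant bracket is local and natural under diffeomorphisms, so it is computed in the charts
of `X`. -/
structure IsGenComplex (J : EndField E X) : Prop extends IsAlmostGenComplex J where
  integrable : ∀ e ∈ atlas E X,
    IsInvolutiveOn (fun y => eigenL (J.inChart e y : GT E →ₗ[ℝ] GT E)) e.target

/-- Generalized Kähler structures: commuting generalized complex structures for which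
`⟨-J₀ J₁ A, B⟩` is positive definite (`-J₀ J₁` is orthogonal with square `id` and the form is
symmetric because `J₀` and `J₁` commute). -/
structure IsGenKaehler (J₀ J₁ : EndField E X) : Prop where
  left : IsGenComplex J₀
  right : IsGenComplex J₁
  comm : ∀ x A, J₀ x (J₁ x A) = J₁ x (J₀ x A)
  pos : ∀ x A, A ≠ 0 → 0 < pairing (-(J₀ x (J₁ x A))) A

/-- `d`-closed, non-degenerate, complex pure spinors on `X`. -/
structure IsClosedNondegeneratePureSpinor (ψ : FormField E X) : Prop where
  smooth : ψ.IsSmooth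
  closed : ψ.IsClosed
  pure : ∀ x, IsPureSpinor (ψ.at x)
  nondegenerate : ∀ x, IsNondegenerateSpinor (ψ.at x)

/-- `J = J_ψ`: the `(-i)`-eigenspace of `J` is `ker ψ`. -/
def IsStructureOfSpinor (J : EndField E X) (ψ : FormField E X) : Prop :=
  ∀ x, eigenL (J x : GT (TangentSpace 𝓘(ℝ, E) x) →ₗ[ℝ] GT (TangentSpace 𝓘(ℝ, E) x))
    = spinorKer (ψ.at x)

/-- Generalized Kähler structures with one pure spinor. The structure `J₁ = J_ψ` is determined
by `ψ`, because `ker ψ` and its conjugate span `(TX ⊕ T*X) ⊗ ℂ`. -/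
structure IsGenKaehlerOnePureSpinor (J₀ : EndField E X) (ψ : FormField E X) : Prop where
  genComplex : IsGenComplex J₀
  spinor : IsClosedNondegeneratePureSpinor ψ
  genKaehler : ∃ J₁ : EndField E X, IsStructureOfSpinor J₁ ψ ∧ IsGenKaehler J₀ J₁

end Manifold

/-! ### Submanifolds -/

section Submanifold

variable {E : Type*} [NormedAddCommGroup E] [NormedSpace ℝ E]
  {X : Type*} [TopologicalSpace X] [ChartedSpace E X]
  {F : Type*} [NormedAddCommGroup F] [NormedSpace ℝ F]
  {M : Type*} [TopologicalSpace M] [ChartedSpace F M]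

/-- The pullback `i*ψ`. -/
def FormField.pullback (i : M → X) (ψ : FormField E X) : FormField F M :=
  fun p k => (ψ (i p) k).compContinuousLinearMap (mfderiv 𝓘(ℝ, F) 𝓘(ℝ, E) i p)

/-- The conormal bundle of `i` is invariant, `J(N*) = N*`. -/
def HasInvariantConormal (i : M → X) (J : EndField E X) : Prop :=
  ∀ p : M, (conormal (mfderiv 𝓘(ℝ, F) 𝓘(ℝ, E) i p)).map
      (J (i p) : GT (TangentSpace 𝓘(ℝ, E) (i p)) →ₗ[ℝ] GT (TangentSpace 𝓘(ℝ, E) (i p)))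
    = conormal (mfderiv 𝓘(ℝ, F) 𝓘(ℝ, E) i p)

/-- `J_M` is the structure induced by `J` on `M`: its `(-i)`-eigenbundle is the image of
`L_J ∩ (TM ⊕ T*X|_M) ⊗ ℂ` in `(TM ⊕ T*M) ⊗ ℂ`. -/
def IsInducedStructure (i : M → X) (J : EndField E X) (JM : EndField F M) : Prop :=
  ∀ p : M,
    eigenL (JM p : GT (TangentSpace 𝓘(ℝ, F) p) →ₗ[ℝ] GT (TangentSpace 𝓘(ℝ, F) p))
      = restrictSubspace (mfderiv 𝓘(ℝ, F) 𝓘(ℝ, E) i p)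
          (eigenL (J (i p) :
            GT (TangentSpace 𝓘(ℝ, E) (i p)) →ₗ[ℝ] GT (TangentSpace 𝓘(ℝ, E) (i p))))

end Submanifold

end GenKaehler

end

open GenKaehler

noncomputable section
set_option linter.unusedSectionVars false
set_option maxSynthPendingDepth 3

namespace GenKaehler

/-! ### Complexification and the (-i)-eigenspace of a real endomorphism. -/

section Complexification

variable {U U' : Type*} [AddCommGroup U] [Module ℝ U] [AddCommGroup U'] [Module ℝ U']

/-! Linear algebra at a point. Let f : V → W be the differential of the immersion, N* its conormal
space and G = ⟨-J₀J₁ ·, ·⟩ the positive definite form. Under the pairing, V ⊕ W* is the annihilator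
of N*, and V ⊕ V* is its quotient by N*. Let τ lift this quotient to the G-orthogonal complement of
N* in V ⊕ W*. The image of τ is the annihilator of N* + J₀J₁N* = N* + J₁N*, which is stable under J₀
and J₁ because J₀N* = N* (`IsLift.map_mem_range₀`, `IsLift.map_mem_range₁`). As τ is an isometry, J₀
and J₁ restrict to a Kähler pair K₀, K₁ on V ⊕ V* (`exists_reduction`), with the prescribed
eigenspaces (`eigenL_eq_restrictSubspace`).

The spinor. Definiteness of G gives W ⊕ W* = (V ⊕ W*) + J₁N*. For n in N* the element J₁n - i n
kills ψ, so J₁n acts on ψ as i n does. Hence every Clifford multiplication on ψ can be done by a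
complex element of V ⊕ W*, and these preserve the vanishing of the pullback. If the pullback of ψ
were zero, so would be that of every iterated Clifford product, and contractions would then show ψ =
0 (`pullForm_ne_zero`). The kernel of the nonzero pullback is isotropic and contains the eigenspace
of K₁, which is maximal isotropic, so the two agree (`spinorKer_pullForm`).

Regularity. A closed formula for τ makes it depend smoothly on the point (`contDiffAt_liftCLM`), and
then so do K₀ and K₁. For involutivity, sections of the eigenbundle on M are extended to sections of
L_J near the image, and the Courant bracket is compatible with restriction
(`isInvolutiveOn_induced`, `courant_related`). Closedness holds because d commutes with pullback. -/

theorem exists_cx (x : ℂ ⊗[ℝ] U) : ∃ a b : U, x = cx a b := by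
  induction x using TensorProduct.induction_on with
  | zero => exact ⟨0, 0, by simp [cx]⟩
  | tmul c u =>
    refine ⟨c.re • u, c.im • u, ?_⟩
    rw [cx, ← TensorProduct.smul_tmul, ← TensorProduct.smul_tmul, ← TensorProduct.add_tmul]
    congr 1
    apply Complex.ext <;> simp
  | add x y hx hy =>
    obtain ⟨a, b, rfl⟩ := hx
    obtain ⟨c, d, rfl⟩ := hy
    refine ⟨a + c, b + d, ?_⟩
    simp only [cx, TensorProduct.tmul_add]
    abel

/-- The real part of an element of a complexification. -/
def cxRe (U : Type*) [AddCommGroup U] [Module ℝ U] : ℂ ⊗[ℝ] U →ₗ[ℝ] U :=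
  (TensorProduct.lid ℝ U).toLinearMap ∘ₗ LinearMap.rTensor U Complex.reLm

/-- The imaginary part of an element of a complexification. -/
def cxIm (U : Type*) [AddCommGroup U] [Module ℝ U] : ℂ ⊗[ℝ] U →ₗ[ℝ] U :=
  (TensorProduct.lid ℝ U).toLinearMap ∘ₗ LinearMap.rTensor U Complex.imLm

@[simp] theorem cxRe_cx (a b : U) : cxRe U (cx a b) = a := by
  simp [cxRe, cx]

@[simp] theorem cxIm_cx (a b : U) : cxIm U (cx a b) = b := by
  simp [cxIm, cx]

theorem cx_inj {a b c d : U} : cx a b = cx c d ↔ a = c ∧ b = d := by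
  refine ⟨fun h => ⟨?_, ?_⟩, fun h => by rw [h.1, h.2]⟩
  · simpa using congrArg (cxRe U) h
  · simpa using congrArg (cxIm U) h

theorem cx_add (a b c d : U) : cx a b + cx c d = cx (a + c) (b + d) := by
  simp only [cx, TensorProduct.tmul_add]
  abel

theorem conj_cx (a b : U) : conj U (cx a b) = cx a (-b) := by
  simp [conj, cx, TensorProduct.neg_tmul, TensorProduct.tmul_neg]

theorem neg_I_smul_cx (a b : U) : -Complex.I • cx a b = cx b (-a) := by
  simp only [cx, smul_add, TensorProduct.smul_tmul', smul_eq_mul, TensorProduct.tmul_neg]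
  simp [TensorProduct.neg_tmul, add_comm]

theorem baseChange_cx (f : U →ₗ[ℝ] U') (a b : U) :
    f.baseChange ℂ (cx a b) = cx (f a) (f b) := by
  simp [cx]

theorem cx_mem_eigenL (J : U →ₗ[ℝ] U) (a b : U) :
    cx a b ∈ eigenL J ↔ J a = b ∧ J b = -a := by
  rw [eigenL, Module.End.mem_eigenspace_iff, baseChange_cx, neg_I_smul_cx, cx_inj]

theorem cx_mem_eigenL_of_sq {J : U →ₗ[ℝ] U} (hJ : ∀ a, J (J a) = -a) (a b : U) :
    cx a b ∈ eigenL J ↔ J a = b := by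
  rw [cx_mem_eigenL]
  refine ⟨And.left, fun h => ⟨h, ?_⟩⟩
  rw [← h, hJ]

/-- The eigenspace is the graph of J over the real parts, so it determines the endomorphism. No
condition on the square of J' is needed. -/
theorem eq_of_eigenL_eq {J J' : U →ₗ[ℝ] U} (hJ : ∀ a, J (J a) = -a)
    (h : eigenL J' = eigenL J) : J' = J := by
  ext a
  have h1 : cx a (J a) ∈ eigenL J' := h ▸ (cx_mem_eigenL_of_sq hJ a _).2 rfl
  exact ((cx_mem_eigenL J' _ _).1 h1).1

theorem isCompl_eigenL_conj {J : U →ₗ[ℝ] U} (hJ : ∀ a, J (J a) = -a) :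
    IsCompl (eigenL J) (conjSubmodule (eigenL J)) := by
  have hmem : ∀ a b : U, cx a b ∈ conjSubmodule (eigenL J) ↔ J a = -b := by
    intro a b
    change conj U (cx a b) ∈ eigenL J ↔ _
    rw [conj_cx, cx_mem_eigenL_of_sq hJ]
  constructor
  · rw [Submodule.disjoint_def]
    intro x hx hx'
    obtain ⟨a, b, rfl⟩ := exists_cx x
    rw [cx_mem_eigenL_of_sq hJ] at hx
    rw [hmem] at hx'
    have hb : b = 0 := by
      have h2 : b = -b := hx.symm.trans hx'
      have h3 : (2 : ℝ) • b = 0 := by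
        rw [two_smul]
        nth_rw 1 [h2]
        exact neg_add_cancel b
      exact (smul_eq_zero.1 h3).resolve_left two_ne_zero
    have ha : a = 0 := by
      have := hJ a
      rw [hx, hb, map_zero] at this
      simpa using this.symm
    simp [ha, hb, cx]
  · rw [codisjoint_iff, eq_top_iff]
    rintro x -
    obtain ⟨a, b, rfl⟩ := exists_cx x
    rw [Submodule.mem_sup]
    -- These are the spectral projections (1 + iJ)/2 and (1 - iJ)/2 applied to a + ib.
    refine ⟨cx ((1 / 2 : ℝ) • (a - J b)) (J ((1 / 2 : ℝ) • (a - J b))),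
      (cx_mem_eigenL_of_sq hJ _ _).2 rfl,
      cx ((1 / 2 : ℝ) • (a + J b)) (-J ((1 / 2 : ℝ) • (a + J b))), (hmem _ _).2 (by simp), ?_⟩
    rw [cx_add, cx_inj]
    constructor
    · module
    · simp only [map_smul, map_sub, map_add, hJ]
      module

/-- Taking real parts is a real isomorphism from the eigenspace onto U. -/
theorem two_mul_finrank_eigenL {J : U →ₗ[ℝ] U} [FiniteDimensional ℝ U]
    (hJ : ∀ a, J (J a) = -a) :
    2 * Module.finrank ℂ (eigenL J) = Module.finrank ℝ U := by
  let e : U ≃ₗ[ℝ] (eigenL J) :=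
    { toFun := fun a => ⟨cx a (J a), (cx_mem_eigenL_of_sq hJ _ _).2 rfl⟩
      map_add' := fun a b => Subtype.ext (by
        change cx (a + b) (J (a + b)) = cx a (J a) + cx b (J b)
        rw [cx_add, map_add])
      map_smul' := fun c a => Subtype.ext (by
        change cx (c • a) (J (c • a)) = c • cx a (J a)
        simp [cx, smul_add, TensorProduct.tmul_smul])
      invFun := fun x => cxRe U x
      left_inv := fun a => by simp
      right_inv := fun x => by
        obtain ⟨x, hx⟩ := x
        obtain ⟨a, b, rfl⟩ := exists_cx x
        have := (cx_mem_eigenL_of_sq hJ _ _).1 hx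
        simp [this] }
  rw [e.finrank_eq, ← Complex.finrank_real_complex]
  exact Module.finrank_mul_finrank ℝ ℂ (eigenL J)

end Complexification

/-! ### The natural pairing and duality in finite dimension. -/

section Pairing

variable {V W : Type*}
  [AddCommGroup V] [Module ℝ V] [TopologicalSpace V]
  [AddCommGroup W] [Module ℝ W] [TopologicalSpace W]
  [IsTopologicalAddGroup V] [ContinuousSMul ℝ V] [IsTopologicalAddGroup W] [ContinuousSMul ℝ W]

theorem pairing_comm (A B : GT V) : pairing A B = pairing B A := by
  simp [pairing, add_comm]

theorem pairing_add_left (A B C : GT V) : pairing (A + B) C = pairing A C + pairing B C := by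
  simp [pairing]; ring

theorem pairing_add_right (A B C : GT V) : pairing A (B + C) = pairing A B + pairing A C := by
  simp [pairing]; ring

theorem pairing_smul_left (c : ℝ) (A B : GT V) : pairing (c • A) B = c * pairing A B := by
  simp [pairing]; ring

theorem pairing_smul_right (c : ℝ) (A B : GT V) : pairing A (c • B) = c * pairing A B := by
  simp [pairing]; ring

theorem pairing_neg_left (A B : GT V) : pairing (-A) B = -pairing A B := by
  simp [pairing]; ring

theorem pairing_neg_right (A B : GT V) : pairing A (-B) = -pairing A B := by
  simp [pairing]; ring

theorem pairing_sub_left (A B C : GT V) : pairing (A - B) C = pairing A C - pairing B C := by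
  simp [pairing]; ring

/-- The pairing as a bilinear form. -/
def pairingForm (V : Type*) [AddCommGroup V] [Module ℝ V] [TopologicalSpace V]
    [IsTopologicalAddGroup V] [ContinuousSMul ℝ V] : GT V →ₗ[ℝ] GT V →ₗ[ℝ] ℝ :=
  LinearMap.mk₂ ℝ pairing pairing_add_left pairing_smul_left pairing_add_right
    pairing_smul_right

@[simp] theorem pairingForm_apply (A B : GT V) : pairingForm V A B = pairing A B := rfl

/-- In finite dimension, vectors are separated by continuous functionals. -/
theorem exists_clm_ne_zero [T2Space V] [FiniteDimensional ℝ V] {v : V} (hv : v ≠ 0) :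
    ∃ ξ : V →L[ℝ] ℝ, ξ v ≠ 0 := by
  by_contra! h
  exact hv ((Module.forall_dual_apply_eq_zero_iff ℝ v).1
    fun φ => h (LinearMap.toContinuousLinearMap φ))

theorem eq_zero_of_pairing [T2Space V] [FiniteDimensional ℝ V] {A : GT V}
    (h : ∀ B, pairing A B = 0) : A = 0 := by
  have h1 : A.1 = 0 := by
    by_contra hv
    obtain ⟨ξ, hξ⟩ := exists_clm_ne_zero hv
    have := h (0, ξ)
    simp [pairing] at this
    exact hξ this
  have h2 : A.2 = 0 := by
    ext v
    have := h (v, 0)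
    simp [pairing] at this
    simpa using this
  exact Prod.ext h1 h2

theorem eq_of_pairing [T2Space V] [FiniteDimensional ℝ V] {A A' : GT V}
    (h : ∀ B, pairing A B = pairing A' B) : A = A' :=
  sub_eq_zero.1 (eq_zero_of_pairing fun B => by rw [pairing_sub_left, h, sub_self])

/-- The range of `f` is the common kernel of the covectors that `f` pulls back to zero. -/
theorem mem_range_of_conormal [T2Space W] [FiniteDimensional ℝ W] (f : V →L[ℝ] W) {w : W}
    (h : ∀ η : W →L[ℝ] ℝ, η.comp f = 0 → η w = 0) : ∃ v, f v = w := by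
  by_contra hw
  have hw' : w ∉ LinearMap.range (f : V →ₗ[ℝ] W) := by simpa using hw
  obtain ⟨φ, hφ, hle⟩ := Submodule.exists_le_ker_of_notMem hw'
  refine hφ (h (LinearMap.toContinuousLinearMap φ) ?_)
  ext v
  exact hle ⟨v, rfl⟩

instance finiteDimensional_clm [T2Space V] [FiniteDimensional ℝ V] :
    FiniteDimensional ℝ (V →L[ℝ] ℝ) :=
  Module.Finite.of_injective (ContinuousLinearMap.coeLM ℝ) ContinuousLinearMap.coe_injective

theorem finrank_GT [T2Space V] [FiniteDimensional ℝ V] :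
    Module.finrank ℝ (GT V) = 2 * Module.finrank ℝ V := by
  have h : Module.finrank ℝ (V →L[ℝ] ℝ) = Module.finrank ℝ V := by
    rw [← (LinearMap.toContinuousLinearMap (𝕜 := ℝ) (E := V) (F' := ℝ)).finrank_eq]
    exact Subspace.dual_finrank_eq
  rw [Module.finrank_prod, h, two_mul]

/-- Surjectivity of the restriction of covectors to a subspace. -/
theorem exists_comp_eq [T2Space V] [FiniteDimensional ℝ V] [T2Space W] [FiniteDimensional ℝ W]
    (f : V →L[ℝ] W) (hf : Function.Injective f) (ξ : V →L[ℝ] ℝ) :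
    ∃ η : W →L[ℝ] ℝ, η.comp f = ξ := by
  obtain ⟨g, hg⟩ := LinearMap.exists_leftInverse_of_injective (f : V →ₗ[ℝ] W)
    (LinearMap.ker_eq_bot.2 hf)
  refine ⟨ξ.comp (LinearMap.toContinuousLinearMap g), ?_⟩
  ext v
  have : g (f v) = v := LinearMap.congr_fun hg v
  simp [this]

end Pairing

/-! ### Reduction of a Kähler pair along an injective linear map. -/

/-- Commuting orthogonal complex structures on `W ⊕ W*` such that `⟨-J₀ J₁ A, B⟩` is positive
definite. -/
structure IsKaehlerPair {W : Type*} [AddCommGroup W] [Module ℝ W] [TopologicalSpace W]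
    [IsTopologicalAddGroup W] [ContinuousSMul ℝ W] (J₀ J₁ : GT W →ₗ[ℝ] GT W) : Prop where
  sq₀ : ∀ A, J₀ (J₀ A) = -A
  sq₁ : ∀ A, J₁ (J₁ A) = -A
  orth₀ : ∀ A B, pairing (J₀ A) (J₀ B) = pairing A B
  orth₁ : ∀ A B, pairing (J₁ A) (J₁ B) = pairing A B
  comm : ∀ A, J₀ (J₁ A) = J₁ (J₀ A)
  pos : ∀ A, A ≠ 0 → 0 < pairing (-(J₀ (J₁ A))) A

/-- `JM` is the endomorphism of `V ⊕ V*` induced by `J` along `f : V → W`. -/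
def Induces {V W : Type*} [AddCommGroup V] [Module ℝ V] [TopologicalSpace V]
    [AddCommGroup W] [Module ℝ W] [TopologicalSpace W]
    [IsTopologicalAddGroup V] [ContinuousSMul ℝ V] [IsTopologicalAddGroup W] [ContinuousSMul ℝ W]
    (f : V →L[ℝ] W) (J : GT W →ₗ[ℝ] GT W) (JM : GT V →ₗ[ℝ] GT V) : Prop :=
  ∀ a b, J (includeGT f a) = includeGT f b → JM (restrictGT f a) = restrictGT f b

/-- `τ` identifies `V ⊕ V*` with the orthogonal complement of the conormal space in `V ⊕ W*`, for
the metric of a Kähler pair. -/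
structure IsLift {V W : Type*} [AddCommGroup V] [Module ℝ V] [TopologicalSpace V]
    [AddCommGroup W] [Module ℝ W] [TopologicalSpace W]
    [IsTopologicalAddGroup V] [ContinuousSMul ℝ V] [IsTopologicalAddGroup W] [ContinuousSMul ℝ W]
    (f : V →L[ℝ] W) (J₀ J₁ : GT W →ₗ[ℝ] GT W) (τ : GT V →ₗ[ℝ] GT W) : Prop where
  fst : ∀ A, (τ A).1 = f A.1
  snd : ∀ A, (τ A).2.comp f = A.2
  orth : ∀ A (η : W →L[ℝ] ℝ), η.comp f = 0 → pairing (J₀ (J₁ (τ A))) ((0, η) : GT W) = 0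

section

variable {V W : Type*}
  [AddCommGroup V] [Module ℝ V] [TopologicalSpace V]
  [AddCommGroup W] [Module ℝ W] [TopologicalSpace W]
  [IsTopologicalAddGroup V] [ContinuousSMul ℝ V] [IsTopologicalAddGroup W] [ContinuousSMul ℝ W]

@[simp] theorem includeGT_apply (f : V →L[ℝ] W) (a : V × (W →L[ℝ] ℝ)) :
    includeGT f a = (f a.1, a.2) := rfl

@[simp] theorem restrictGT_apply (f : V →L[ℝ] W) (a : V × (W →L[ℝ] ℝ)) :
    restrictGT f a = (a.1, a.2.comp f) := rfl

theorem pairing_include_restrict (f : V →L[ℝ] W) (a b : V × (W →L[ℝ] ℝ)) :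
    pairing (includeGT f a) (includeGT f b) = pairing (restrictGT f a) (restrictGT f b) := by
  simp [pairing]

theorem conormal_invariant {f : V →L[ℝ] W} {J₀ : GT W →ₗ[ℝ] GT W}
    (hN : (conormal f).map J₀ = conormal f) {η : W →L[ℝ] ℝ} (hη : η.comp f = 0) :
    ∃ η' : W →L[ℝ] ℝ, η'.comp f = 0 ∧ J₀ (0, η) = (0, η') := by
  have h : J₀ (0, η) ∈ conormal f := by
    rw [← hN]
    exact ⟨(0, η), ⟨rfl, hη⟩, rfl⟩
  exact ⟨(J₀ (0, η)).2, h.2, Prod.ext h.1 rfl⟩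

namespace IsKaehlerPair

variable {J₀ J₁ : GT W →ₗ[ℝ] GT W} (h : IsKaehlerPair J₀ J₁)
include h

theorem skew₀ (A B : GT W) : pairing (J₀ A) B = -pairing A (J₀ B) := by
  rw [← h.orth₀ A (J₀ B), h.sq₀, pairing_neg_right, neg_neg]

theorem skew₁ (A B : GT W) : pairing (J₁ A) B = -pairing A (J₁ B) := by
  rw [← h.orth₁ A (J₁ B), h.sq₁, pairing_neg_right, neg_neg]

theorem symm (A B : GT W) : pairing (J₀ (J₁ A)) B = pairing A (J₀ (J₁ B)) := by
  rw [h.skew₀, h.skew₁, neg_neg, h.comm]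

theorem eq_zero {A : GT W} (hA : pairing (J₀ (J₁ A)) A = 0) : A = 0 := by
  by_contra hne
  have := h.pos A hne
  rw [pairing_neg_left, hA] at this
  simp at this

end IsKaehlerPair

namespace IsLift

variable {f : V →L[ℝ] W} {J₀ J₁ : GT W →ₗ[ℝ] GT W} {τ : GT V →ₗ[ℝ] GT W}
  (hτ : IsLift f J₀ J₁ τ)
include hτ

/-- The lift as an element of `V ⊕ W*`. -/
theorem include_eq (A : GT V) : includeGT f (A.1, (τ A).2) = τ A := by
  rw [includeGT_apply]
  exact Prod.ext (hτ.fst A).symm rfl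

theorem restrict_eq (A : GT V) : restrictGT f (A.1, (τ A).2) = A := by
  rw [restrictGT_apply]
  exact Prod.ext rfl (hτ.snd A)

theorem pairing_eq (A B : GT V) : pairing (τ A) (τ B) = pairing A B := by
  rw [← hτ.include_eq A, ← hτ.include_eq B, pairing_include_restrict, hτ.restrict_eq,
    hτ.restrict_eq]

theorem pairing_conormal (A : GT V) {η : W →L[ℝ] ℝ} (hη : η.comp f = 0) :
    pairing (τ A) ((0, η) : GT W) = 0 := by
  have : η (f A.1) = 0 := DFunLike.congr_fun hη A.1
  simp [pairing, hτ.fst, this]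

theorem injective [T2Space V] [FiniteDimensional ℝ V] : Function.Injective τ := by
  intro A B hAB
  refine eq_of_pairing fun C => ?_
  rw [← hτ.pairing_eq, hAB, hτ.pairing_eq]

variable (h : IsKaehlerPair J₀ J₁)
include h

/-- The difference of the two sides is a conormal covector that is G-orthogonal to N*, in particular
to itself, so it vanishes by definiteness. -/
theorem eq_of_orth {c : V × (W →L[ℝ] ℝ)}
    (hc : ∀ η : W →L[ℝ] ℝ, η.comp f = 0 →
      pairing (J₀ (J₁ (includeGT f c))) ((0, η) : GT W) = 0) :
    τ (restrictGT f c) = includeGT f c := by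
  set n : W →L[ℝ] ℝ := (τ (restrictGT f c)).2 - c.2 with hn
  have hn0 : n.comp f = 0 := by
    rw [hn, ContinuousLinearMap.sub_comp, hτ.snd, restrictGT_apply, sub_self]
  have hdiff : τ (restrictGT f c) - includeGT f c = ((0, n) : GT W) := by
    refine Prod.ext ?_ rfl
    rw [Prod.fst_sub, hτ.fst, restrictGT_apply, includeGT_apply, sub_self]
  rw [← sub_eq_zero, hdiff]
  refine h.eq_zero ?_
  rw [← hdiff, map_sub, map_sub, pairing_sub_left, hdiff, hτ.orth _ n hn0, hc n hn0, sub_self]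

variable [T2Space W] [FiniteDimensional ℝ W] [T2Space V] [FiniteDimensional ℝ V]

/-- The image of τ is cut out by two conditions: the first puts X into V ⊕ W*, the second makes it
G-orthogonal to N*. -/
theorem mem_range {X : GT W} (hX : ∀ η : W →L[ℝ] ℝ, η.comp f = 0 → pairing X ((0, η) : GT W) = 0)
    (hX' : ∀ η : W →L[ℝ] ℝ, η.comp f = 0 → pairing (J₀ (J₁ X)) ((0, η) : GT W) = 0) :
    ∃ A, τ A = X := by
  obtain ⟨v, hv⟩ := mem_range_of_conormal f (w := X.1) fun η hη => by
    have := hX η hη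
    simpa [pairing] using this
  have hXv : includeGT f (v, X.2) = X := by
    rw [includeGT_apply]
    exact Prod.ext hv rfl
  refine ⟨restrictGT f (v, X.2), ?_⟩
  rw [hτ.eq_of_orth h (by rwa [hXv]), hXv]

variable (hN : (conormal f).map J₀ = conormal f)
include hN

/-- J₀ is skew, commutes with J₁ and preserves N*, so it preserves each of the two conditions of
`mem_range` separately. -/
theorem map_mem_range₀ (A : GT V) : ∃ B, τ B = J₀ (τ A) := by
  refine hτ.mem_range h (fun η hη => ?_) (fun η hη => ?_)
  · obtain ⟨η', hη', e⟩ := conormal_invariant hN hη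
    rw [h.skew₀, e, hτ.pairing_conormal A hη', neg_zero]
  · obtain ⟨η', hη', e⟩ := conormal_invariant hN hη
    rw [← h.comm, h.skew₀, e, hτ.orth A η' hη', neg_zero]

/-- J₁ exchanges the two conditions of `mem_range`, up to sign and up to replacing the conormal
vector n by J₀n. -/
theorem map_mem_range₁ (A : GT V) : ∃ B, τ B = J₁ (τ A) := by
  refine hτ.mem_range h (fun η hη => ?_) (fun η hη => ?_)
  · obtain ⟨η', hη', e⟩ := conormal_invariant hN hη
    have := hτ.orth A η' hη'
    rw [← e, h.orth₀] at this
    exact this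
  · obtain ⟨η', hη', e⟩ := conormal_invariant hN hη
    rw [h.sq₁, map_neg, pairing_neg_left, h.skew₀, e, hτ.pairing_conormal A hη', neg_zero, neg_zero]

omit h hN in
theorem exists_conormal (a : V × (W →L[ℝ] ℝ)) : ∃ n : W →L[ℝ] ℝ, n.comp f = 0 ∧
    includeGT f a = τ (restrictGT f a) + ((0, n) : GT W) := by
  refine ⟨a.2 - (τ (restrictGT f a)).2, ?_, Prod.ext ?_ ?_⟩
  · rw [ContinuousLinearMap.sub_comp, hτ.snd, restrictGT_apply, sub_self]
  · rw [Prod.fst_add, hτ.fst, restrictGT_apply, includeGT_apply, add_zero]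
  · simp

omit h hN in
theorem eq_restrict {A : GT V} {n : W →L[ℝ] ℝ} (hn : n.comp f = 0) {b : V × (W →L[ℝ] ℝ)}
    (hb : τ A + ((0, n) : GT W) = includeGT f b) : A = restrictGT f b := by
  refine eq_of_pairing fun B => ?_
  have h1 : pairing ((0, n) : GT W) (τ B) = 0 := by
    rw [pairing_comm, hτ.pairing_conormal B hn]
  rw [← hτ.pairing_eq, ← add_zero (pairing (τ _) _), ← h1, ← pairing_add_left, hb,
    ← hτ.include_eq B, pairing_include_restrict, hτ.restrict_eq]

/-- An element of V ⊕ W* is a lift plus a conormal covector; J₀ keeps the latter conormal, where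
restriction does not see it. -/
theorem induces₀ {JM : GT V →ₗ[ℝ] GT V} (hJM : ∀ A, J₀ (τ A) = τ (JM A)) :
    Induces f J₀ JM := by
  intro a b hab
  obtain ⟨n, hn, hdiff⟩ := hτ.exists_conormal a
  obtain ⟨n', hn', e⟩ := conormal_invariant hN hn
  rw [hdiff, map_add, hJM, e] at hab
  exact hτ.eq_restrict hn' hab

theorem induces₁ {JM : GT V →ₗ[ℝ] GT V} (hJM : ∀ A, J₁ (τ A) = τ (JM A)) :
    Induces f J₁ JM := by
  intro a b hab
  obtain ⟨n, hn, hdiff⟩ := hτ.exists_conormal a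
  obtain ⟨n', hn', e⟩ := conormal_invariant hN hn
  rw [hdiff, map_add, hJM] at hab
  -- J₁ does not preserve N*, but if the image stays in V ⊕ W* the conormal part n must vanish:
  -- pairing with J₀n in N* gives ⟨J₁n, J₀n⟩ = G(n, n) = 0.
  have hn0 : ((0, n) : GT W) = 0 := by
    refine h.eq_zero ?_
    have h2 : n' (f b.1) = 0 := DFunLike.congr_fun hn' b.1
    have h1 : pairing (includeGT f b) ((0, n') : GT W) = 0 := by
      simp [pairing, h2]
    rw [← hab, pairing_add_left, hτ.pairing_conormal _ hn', zero_add] at h1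
    rw [h.skew₀, e, h1, neg_zero]
  refine hτ.eq_restrict (n := 0) (by simp) ?_
  rw [← hab, hn0]
  simp

end IsLift

variable [T2Space W] [FiniteDimensional ℝ W] [T2Space V] [FiniteDimensional ℝ V]

/-- The form is definite on V ⊕ W*, so the kernel of the restriction map, the copy of N*, is
complemented by its orthogonal. Restriction to that complement is still onto V ⊕ V*, and τ is a
section of it. -/
theorem exists_isLift {f : V →L[ℝ] W} (hf : Function.Injective f) {J₀ J₁ : GT W →ₗ[ℝ] GT W}
    (h : IsKaehlerPair J₀ J₁) : ∃ τ : GT V →ₗ[ℝ] GT W, IsLift f J₀ J₁ τ := by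
  let B : LinearMap.BilinForm ℝ (V × (W →L[ℝ] ℝ)) :=
    (pairingForm W).compl₁₂ (J₀ ∘ₗ J₁ ∘ₗ includeGT f) (includeGT f)
  have hB : ∀ a b, B a b = pairing (J₀ (J₁ (includeGT f a))) (includeGT f b) := fun a b => rfl
  have hinc : Function.Injective (includeGT f) := by
    intro a b hab
    rw [includeGT_apply, includeGT_apply, Prod.mk.injEq] at hab
    exact Prod.ext (hf hab.1) hab.2
  have hsymm : B.IsSymm := ⟨fun a b => by
    simp only [hB]
    rw [h.symm, pairing_comm]⟩
  have hdef : ∀ a, B a a = 0 → a = 0 := fun a ha =>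
    hinc ((h.eq_zero ha).trans (map_zero _).symm)
  have hnd : (B.restrict (LinearMap.ker (restrictGT f))).Nondegenerate :=
    ⟨fun a ha => Subtype.ext (hdef a (ha a)), fun a ha => Subtype.ext (hdef a (ha a))⟩
  have hc := LinearMap.BilinForm.isCompl_orthogonal_of_restrict_nondegenerate
    hsymm.isRefl hnd
  have hsurj : Function.Surjective
      ((restrictGT f).domRestrict (B.orthogonal (LinearMap.ker (restrictGT f)))) := by
    intro A
    obtain ⟨η, hη⟩ := exists_comp_eq f hf A.2
    have hA : restrictGT f (A.1, η) = A := Prod.ext rfl hη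
    obtain ⟨k, hk, q, hq, hkq⟩ := Submodule.mem_sup.1 (hc.sup_eq_top ▸ Submodule.mem_top :
      ((A.1, η) : V × (W →L[ℝ] ℝ)) ∈ LinearMap.ker (restrictGT f) ⊔ B.orthogonal _)
    refine ⟨⟨q, hq⟩, ?_⟩
    rw [LinearMap.domRestrict_apply, ← hA, ← hkq, map_add, LinearMap.mem_ker.1 hk, zero_add]
  obtain ⟨σ, hσ⟩ := LinearMap.exists_rightInverse_of_surjective _ (LinearMap.range_eq_top.2 hsurj)
  have hσ' : ∀ A, restrictGT f (σ A : V × (W →L[ℝ] ℝ)) = A := fun A => LinearMap.congr_fun hσ A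
  refine ⟨includeGT f ∘ₗ Submodule.subtype _ ∘ₗ σ, ⟨fun A => ?_, fun A => ?_, fun A η hη => ?_⟩⟩
  · exact congrArg f (congrArg Prod.fst (hσ' A))
  · exact congrArg Prod.snd (hσ' A)
  · have hmem : ((0, η) : V × (W →L[ℝ] ℝ)) ∈ LinearMap.ker (restrictGT f) :=
      LinearMap.mem_ker.2 (Prod.ext rfl hη)
    have h1 : B (0, η) (σ A) = 0 := (σ A).2 _ hmem
    rw [hB, h.symm, pairing_comm] at h1
    simpa using h1

/-- The restriction of an endomorphism preserving the range of an injective linear map. -/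
theorem exists_restriction {U U' : Type*} [AddCommGroup U] [Module ℝ U] [AddCommGroup U']
    [Module ℝ U'] {τ : U →ₗ[ℝ] U'} (hτ : Function.Injective τ) {J : U' →ₗ[ℝ] U'}
    (hJ : ∀ A, ∃ B, τ B = J (τ A)) : ∃ JM : U →ₗ[ℝ] U, ∀ A, J (τ A) = τ (JM A) := by
  refine ⟨(LinearEquiv.ofInjective τ hτ).symm.toLinearMap ∘ₗ
    (J ∘ₗ τ).codRestrict (LinearMap.range τ) fun A => hJ A, fun A => ?_⟩
  have := LinearEquiv.ofInjective_symm_apply (f := τ) (h := hτ)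
    ((J ∘ₗ τ).codRestrict (LinearMap.range τ) (fun A => hJ A) A)
  exact this.symm

/-- The image of τ is stable under J₀ and J₁ and τ is an injective isometry, so all the identities
of a Kähler pair are inherited. -/
theorem exists_reduction {f : V →L[ℝ] W} (hf : Function.Injective f) {J₀ J₁ : GT W →ₗ[ℝ] GT W}
    (h : IsKaehlerPair J₀ J₁) (hN : (conormal f).map J₀ = conormal f) :
    ∃ (τ : GT V →ₗ[ℝ] GT W) (K₀ K₁ : GT V →ₗ[ℝ] GT V), IsLift f J₀ J₁ τ ∧
      (∀ A, J₀ (τ A) = τ (K₀ A)) ∧ (∀ A, J₁ (τ A) = τ (K₁ A)) ∧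
      Induces f J₀ K₀ ∧ Induces f J₁ K₁ ∧ IsKaehlerPair K₀ K₁ := by
  obtain ⟨τ, hτ⟩ := exists_isLift hf h
  obtain ⟨K₀, h₀⟩ := exists_restriction hτ.injective (hτ.map_mem_range₀ h hN)
  obtain ⟨K₁, h₁⟩ := exists_restriction hτ.injective (hτ.map_mem_range₁ h hN)
  refine ⟨τ, K₀, K₁, hτ, h₀, h₁, hτ.induces₀ h hN h₀, hτ.induces₁ h hN h₁, ?_⟩
  constructor
  · intro A
    apply hτ.injective
    rw [← h₀, ← h₀, h.sq₀, map_neg]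
  · intro A
    apply hτ.injective
    rw [← h₁, ← h₁, h.sq₁, map_neg]
  · intro A B
    rw [← hτ.pairing_eq, ← h₀, ← h₀, h.orth₀, hτ.pairing_eq]
  · intro A B
    rw [← hτ.pairing_eq, ← h₁, ← h₁, h.orth₁, hτ.pairing_eq]
  · intro A
    apply hτ.injective
    rw [← h₀, ← h₁, ← h₁, ← h₀, h.comm]
  · intro A hA
    rw [← hτ.pairing_eq, map_neg, ← h₀, ← h₁]
    exact h.pos _ fun h0 => hA (hτ.injective (h0.trans (map_zero τ).symm))

/-- Induced endomorphisms are determined by lifts. -/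
theorem Induces.comm_lift {f : V →L[ℝ] W} {J₀ J₁ J : GT W →ₗ[ℝ] GT W} {τ : GT V →ₗ[ℝ] GT W}
    {JM : GT V →ₗ[ℝ] GT V} (hJM : Induces f J JM) (hτ : IsLift f J₀ J₁ τ)
    (hJ : ∀ A, ∃ B, τ B = J (τ A)) (A : GT V) : J (τ A) = τ (JM A) := by
  obtain ⟨B, hB⟩ := hJ A
  have := hJM _ _ ((congrArg J (hτ.include_eq A)).trans (hB.symm.trans (hτ.include_eq B).symm))
  rw [hτ.restrict_eq, hτ.restrict_eq] at this
  rw [this, hB]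

/-- The lift provides an element of L_J above each eigenvector of JM. Conversely, `Induces` covers
every element of L_J over V ⊕ W*, not only the lifts. -/
theorem eigenL_eq_restrictSubspace {f : V →L[ℝ] W} {J₀ J₁ J : GT W →ₗ[ℝ] GT W}
    {τ : GT V →ₗ[ℝ] GT W} {JM : GT V →ₗ[ℝ] GT V} (hJM : Induces f J JM) (hτ : IsLift f J₀ J₁ τ)
    (hτJ : ∀ A, J (τ A) = τ (JM A)) (hJ : ∀ A, J (J A) = -A) (hJM2 : ∀ A, JM (JM A) = -A) :
    eigenL JM = restrictSubspace f (eigenL J) := by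
  ext x
  obtain ⟨a, b, rfl⟩ := exists_cx x
  rw [cx_mem_eigenL_of_sq hJM2, restrictSubspace, Submodule.mem_map]
  constructor
  · rintro rfl
    refine ⟨cx (a.1, (τ a).2) ((JM a).1, (τ (JM a)).2), ?_, ?_⟩
    · rw [Submodule.mem_comap, baseChange_cx, cx_mem_eigenL_of_sq hJ, hτ.include_eq,
        hτ.include_eq, hτJ]
    · rw [baseChange_cx, hτ.restrict_eq, hτ.restrict_eq]
  · rintro ⟨x, hx, hxe⟩
    obtain ⟨c, d, rfl⟩ := exists_cx x
    rw [Submodule.mem_comap, baseChange_cx, cx_mem_eigenL_of_sq hJ] at hx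
    rw [baseChange_cx, cx_inj] at hxe
    rw [← hxe.1, ← hxe.2]
    exact hJM _ _ hx

end

/-! ### Clifford algebra and the pullback of pure spinors. -/

section

variable {V W : Type*}
  [AddCommGroup V] [Module ℝ V] [TopologicalSpace V]
  [AddCommGroup W] [Module ℝ W] [TopologicalSpace W]
  [IsTopologicalAddGroup V] [ContinuousSMul ℝ V] [IsTopologicalAddGroup W] [ContinuousSMul ℝ W]

theorem covectorWedge_apply {k : ℕ} (ξ : V →L[ℝ] ℝ) (φ : V [⋀^Fin k]→ₗ[ℝ] ℂ)
    (v : Fin (k + 1) → V) :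
    covectorWedge ξ φ v = ∑ i : Fin (k + 1), (-1) ^ (i : ℕ) • ξ (v i) • φ (i.removeNth v) := by
  simp [covectorWedge, AlternatingMap.alternatizeUncurryFin_apply]

/-- The sum is the double alternatization of a bilinear map that is symmetric in its two arguments,
hence zero. -/
theorem covectorWedge_anticomm {k : ℕ} (ξ η : V →L[ℝ] ℝ) (φ : V [⋀^Fin k]→ₗ[ℝ] ℂ) :
    covectorWedge ξ (covectorWedge η φ) + covectorWedge η (covectorWedge ξ φ) = 0 := by
  let f : V →ₗ[ℝ] V →ₗ[ℝ] V [⋀^Fin k]→ₗ[ℝ] ℂ :=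
    LinearMap.mk₂ ℝ (fun v w => (ξ v * η w + η v * ξ w) • φ)
      (fun a b c => by simp only [map_add]; module)
      (fun a b c => by simp only [map_smul, smul_eq_mul]; module)
      (fun a b c => by simp only [map_add]; module)
      (fun a b c => by simp only [map_smul, smul_eq_mul]; module)
  have := AlternatingMap.alternatizeUncurryFin_alternatizeUncurryFinLM_comp_of_symmetric
    (f := f) (fun x y => by simp [f, mul_comm, add_comm])
  rw [← this, covectorWedge, covectorWedge, covectorWedge, covectorWedge,
    ← AlternatingMap.alternatizeUncurryFin_add]
  congr 1
  ext v w
  simp [f, AlternatingMap.alternatizeUncurryFin_apply, Finset.mul_sum, ← Finset.sum_add_distrib]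
  refine Finset.sum_congr rfl fun i _ => ?_
  ring

/-- Polarization of the vanishing of a double contraction with one vector. -/
theorem curryLeft_curryLeft_anticomm {k : ℕ} (φ : V [⋀^Fin (k + 2)]→ₗ[ℝ] ℂ) (v w : V) :
    (φ.curryLeft v).curryLeft w + (φ.curryLeft w).curryLeft v = 0 := by
  have h := AlternatingMap.curryLeft_same φ (v + w)
  have h1 := AlternatingMap.curryLeft_same φ v
  have h2 := AlternatingMap.curryLeft_same φ w
  ext u
  have h' := congrArg (fun g => g u) h
  have h1' := congrArg (fun g => g u) h1
  have h2' := congrArg (fun g => g u) h2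
  simp only [map_add, AlternatingMap.curryLeft_add, LinearMap.add_apply, AlternatingMap.add_apply, AlternatingMap.zero_apply] at h' h1' h2' ⊢
  rw [h1', h2'] at h'
  simpa [add_comm] using h'

/-- In the expansion of the wedge product with v in the first slot, the summand of index 0 is ξ(v)φ,
and the others cancel the second term because of the shift of sign. -/
theorem curryLeft_covectorWedge {k : ℕ} (ξ : V →L[ℝ] ℝ) (φ : V [⋀^Fin (k + 1)]→ₗ[ℝ] ℂ) (v : V) :
    (covectorWedge ξ φ).curryLeft v + covectorWedge ξ (φ.curryLeft v) = ξ v • φ := by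
  ext u
  simp only [AlternatingMap.add_apply, AlternatingMap.curryLeft_apply_apply, covectorWedge_apply,
    AlternatingMap.smul_apply]
  rw [Fin.sum_univ_succ]
  simp only [Fin.val_zero, pow_zero, one_smul, Matrix.cons_val_zero, Fin.val_succ,
    Matrix.cons_val_succ]
  rw [add_assoc, ← Finset.sum_add_distrib, Finset.sum_eq_zero, add_zero]
  · rfl
  · intro i _
    have : (i.succ.removeNth (Matrix.vecCons v u) : Fin (k + 1) → V)
        = Matrix.vecCons v (i.removeNth u) := by
      ext j
      refine Fin.cases ?_ (fun j => ?_) j <;> simp [Fin.removeNth, Fin.succ_succAbove_succ]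
    rw [this, pow_succ]
    module

theorem curryLeft_covectorWedge_zero (ξ : V →L[ℝ] ℝ) (φ : V [⋀^Fin 0]→ₗ[ℝ] ℂ) (v : V) :
    (covectorWedge ξ φ).curryLeft v = ξ v • φ := by
  ext u
  simp [covectorWedge_apply]

/-- The Clifford action of an element of `V ⊕ V*` on forms. -/
def cliffordAction (A : GT V) : MixedForm V →ₗ[ℂ] MixedForm V where
  toFun φ := clifford φ A
  map_add' φ ψ := by
    funext k
    cases k with
    | zero => rfl
    | succ k =>
      ext v
      simp [clifford, cliffordFun, covectorWedge_apply, smul_add, Finset.sum_add_distrib]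
      ring
  map_smul' c φ := by
    funext k
    cases k with
    | zero => rfl
    | succ k =>
      ext v
      simp [clifford, cliffordFun, covectorWedge_apply, Finset.mul_sum]
      refine Finset.sum_congr rfl fun i _ => ?_
      ring

theorem covectorWedge_add {k : ℕ} (ξ : V →L[ℝ] ℝ) (φ φ' : V [⋀^Fin k]→ₗ[ℝ] ℂ) :
    covectorWedge ξ (φ + φ') = covectorWedge ξ φ + covectorWedge ξ φ' := by
  ext v
  simp only [covectorWedge_apply, AlternatingMap.add_apply, smul_add, Finset.sum_add_distrib]

theorem clifford_zero (A : GT V) (φ : MixedForm V) : clifford φ A 0 = (φ 1).curryLeft A.1 := rfl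

theorem clifford_succ (A : GT V) (φ : MixedForm V) (k : ℕ) :
    clifford φ A (k + 1) = (φ (k + 2)).curryLeft A.1 + covectorWedge A.2 (φ k) := rfl

/-- The Clifford relation. -/
theorem clifford_anticomm (A B : GT V) (φ : MixedForm V) :
    clifford (clifford φ B) A + clifford (clifford φ A) B = (2 * pairing A B : ℝ) • φ := by
  have h2 : (2 * pairing A B : ℝ) = B.2 A.1 + A.2 B.1 := by simp [pairing]; ring
  rw [h2]
  funext k
  rw [Pi.add_apply, Pi.smul_apply, add_smul]
  -- Degrees 0 and 1 have no double wedge, and degree 0 also has no wedge of a contraction.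
  match k with
  | 0 =>
    simp only [clifford_zero, clifford_succ, AlternatingMap.curryLeft_add, LinearMap.add_apply]
    rw [← curryLeft_covectorWedge_zero, ← curryLeft_covectorWedge_zero]
    linear_combination (norm := module) curryLeft_curryLeft_anticomm (φ 2) B.1 A.1
  | 1 =>
    simp only [clifford_zero, clifford_succ, AlternatingMap.curryLeft_add, LinearMap.add_apply]
    rw [← curryLeft_covectorWedge, ← curryLeft_covectorWedge]
    linear_combination (norm := module) curryLeft_curryLeft_anticomm (φ 3) B.1 A.1
  | k + 2 =>
    simp only [clifford_succ, AlternatingMap.curryLeft_add, LinearMap.add_apply, covectorWedge_add]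
    rw [← curryLeft_covectorWedge, ← curryLeft_covectorWedge]
    linear_combination (norm := module) curryLeft_curryLeft_anticomm (φ (k + 4)) B.1 A.1
      + covectorWedge_anticomm A.2 B.2 (φ k)

/-- The pullback of a form of mixed degree. -/
def pullForm (f : V →L[ℝ] W) : MixedForm W →ₗ[ℂ] MixedForm V where
  toFun φ k := (φ k).compLinearMap (f : V →ₗ[ℝ] W)
  map_add' _ _ := rfl
  map_smul' _ _ := rfl

theorem pullForm_apply (f : V →L[ℝ] W) (φ : MixedForm W) (k : ℕ) :
    pullForm f φ k = (φ k).compLinearMap (f : V →ₗ[ℝ] W) := rfl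

/-- Contraction passes through the pullback only for vectors in the image of f, which is why the
element is taken in V ⊕ W*. -/
theorem pullForm_clifford (f : V →L[ℝ] W) (φ : MixedForm W) (a : V × (W →L[ℝ] ℝ)) :
    pullForm f (clifford φ (includeGT f a)) = clifford (pullForm f φ) (restrictGT f a) := by
  funext k
  cases k with
  | zero =>
    rw [pullForm_apply, clifford_zero, clifford_zero, pullForm_apply]
    exact (AlternatingMap.curryLeft_compLinearMap _ _ _).symm
  | succ k =>
    rw [pullForm_apply, clifford_succ, clifford_succ, pullForm_apply, pullForm_apply]
    rw [AlternatingMap.curryLeft_compLinearMap, AlternatingMap.add_compLinearMap]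
    congr 1
    ext v
    simp only [covectorWedge_apply, AlternatingMap.compLinearMap_apply]
    rfl

theorem cx_mem_spinorKer (φ : MixedForm V) (a b : GT V) :
    cx a b ∈ spinorKer φ ↔ clifford φ a + Complex.I • clifford φ b = 0 := by
  rw [spinorKer, LinearMap.mem_ker, cx, map_add, LinearMap.liftBaseChange_tmul,
    LinearMap.liftBaseChange_tmul, one_smul]

/-- Forms all of whose images under at most `n` Clifford multiplications pull back to zero. -/
def pullKer (f : V →L[ℝ] W) : ℕ → Submodule ℂ (MixedForm W)
  | 0 => LinearMap.ker (pullForm f)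
  | n + 1 => pullKer f n ⊓ ⨅ A : GT W, (pullKer f n).comap (cliffordAction A)

theorem mem_pullKer_zero {f : V →L[ℝ] W} {φ : MixedForm W} :
    φ ∈ pullKer f 0 ↔ pullForm f φ = 0 := LinearMap.mem_ker

theorem mem_pullKer_succ {f : V →L[ℝ] W} {n : ℕ} {φ : MixedForm W} :
    φ ∈ pullKer f (n + 1) ↔ φ ∈ pullKer f n ∧ ∀ A, clifford φ A ∈ pullKer f n := by
  simp only [pullKer, Submodule.mem_inf, Submodule.mem_iInf, Submodule.mem_comap]
  rfl

theorem real_smul_mem {φ : MixedForm W} {S : Submodule ℂ (MixedForm W)} (c : ℝ) (h : φ ∈ S) :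
    c • φ ∈ S := by
  have h1 : c • φ = (c : ℂ) • φ := by
    funext k
    ext v
    simp
  rw [h1]
  exact S.smul_mem _ h

/-- An element of V ⊕ W* can be moved past any other factor by the Clifford relation, at the cost of
a multiple of φ itself, until it is the last factor before the pullback. -/
theorem clifford_include_mem_pullKer {f : V →L[ℝ] W} {n : ℕ} {φ : MixedForm W}
    (h : φ ∈ pullKer f n) (a : V × (W →L[ℝ] ℝ)) :
    clifford φ (includeGT f a) ∈ pullKer f n := by
  induction n generalizing φ with
  | zero =>
    rw [mem_pullKer_zero] at h ⊢
    rw [pullForm_clifford, h]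
    exact map_zero (cliffordAction _)
  | succ n ih =>
    rw [mem_pullKer_succ] at h ⊢
    refine ⟨ih h.1, fun A => ?_⟩
    rw [eq_sub_of_add_eq (clifford_anticomm A (includeGT f a) φ)]
    exact Submodule.sub_mem _ (real_smul_mem _ h.1) (ih (h.2 A))

/-- Contracting with n vectors brings the component of degree n down to degree 0, where the pullback
loses nothing. -/
theorem apply_eq_zero_of_mem_pullKer {f : V →L[ℝ] W} {n : ℕ} {φ : MixedForm W}
    (h : φ ∈ pullKer f n) : φ n = 0 := by
  induction n generalizing φ with
  | zero =>
    rw [mem_pullKer_zero] at h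
    ext v
    have := congrArg (fun g => g 0 ![]) h
    simp only [pullForm_apply, AlternatingMap.compLinearMap_apply] at this
    rw [Subsingleton.elim v (fun i => f (![] i))]
    exact this
  | succ n ih =>
    rw [mem_pullKer_succ] at h
    ext v
    have h1 := ih (h.2 (v 0, 0))
    have h2 : (φ (n + 1)).curryLeft (v 0) = 0 := by
      cases n with
      | zero => exact h1
      | succ n =>
        rw [clifford_succ] at h1
        have : covectorWedge (0 : W →L[ℝ] ℝ) (φ n) = 0 := by
          ext u
          simp [covectorWedge_apply]
        rwa [this, add_zero] at h1
    have h3 := congrArg (fun g => g (Fin.tail v)) h2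
    simp only [AlternatingMap.curryLeft_apply_apply] at h3
    rw [show Matrix.vecCons (v 0) (Fin.tail v) = v from Fin.cons_self_tail v] at h3
    exact h3

variable [T2Space W] [FiniteDimensional ℝ W] [T2Space V] [FiniteDimensional ℝ V]

/-- Representation of functionals on a subspace on which a bilinear form is nondegenerate. -/
theorem exists_representative {U : Type*} [AddCommGroup U] [Module ℝ U] [FiniteDimensional ℝ U]
    (B : U →ₗ[ℝ] U →ₗ[ℝ] ℝ) (N : Submodule ℝ U)
    (hB : ∀ n ∈ N, (∀ m ∈ N, B n m = 0) → n = 0) (φ : U →ₗ[ℝ] ℝ) :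
    ∃ n ∈ N, ∀ m ∈ N, B n m = φ m := by
  let Φ : N →ₗ[ℝ] Module.Dual ℝ N := B.compl₁₂ N.subtype N.subtype
  have hinj : Function.Injective Φ := by
    refine (injective_iff_map_eq_zero Φ).2 fun n hn => Subtype.ext (hB n n.2 fun m hm => ?_)
    exact LinearMap.congr_fun hn ⟨m, hm⟩
  obtain ⟨n, hn⟩ := (LinearMap.injective_iff_surjective_of_finrank_eq_finrank
      Subspace.dual_finrank_eq.symm).1 hinj (φ ∘ₗ N.subtype)
  exact ⟨n, n.2, fun m hm => LinearMap.congr_fun hn ⟨m, hm⟩⟩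

/-- Every vector differs from an element of `J₁(N*)` by an element of `V ⊕ W*`. -/
theorem exists_sub_mem {f : V →L[ℝ] W} {J₀ J₁ : GT W →ₗ[ℝ] GT W}
    (h : IsKaehlerPair J₀ J₁) (hN : (conormal f).map J₀ = conormal f) (A : GT W) :
    ∃ (n : W →L[ℝ] ℝ) (c : V × (W →L[ℝ] ℝ)), n.comp f = 0 ∧
      A = includeGT f c + J₁ (0, n) := by
  -- Since ⟨J₁n, J₀m⟩ = G(n, m) is definite on N*, some n in N* makes A - J₁n annihilate J₀N* = N*,
  -- which puts A - J₁n into V ⊕ W*.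
  obtain ⟨n, hn, hn'⟩ := exists_representative ((pairingForm W).compl₁₂ J₁ J₀) (conormal f)
    (fun n hn hn0 => h.eq_zero (by
      have h1 : pairing (J₁ n) (J₀ n) = 0 := hn0 n hn
      rw [h.skew₀, h1, neg_zero])) ((pairingForm W A) ∘ₗ J₀)
  have hn2 : n = (0, n.2) := Prod.ext hn.1 rfl
  obtain ⟨v, hv⟩ := mem_range_of_conormal f (w := (A - J₁ n).1) fun η hη => by
    have h1 : ((0, η) : GT W) ∈ (conormal f).map J₀ := by
      rw [hN]
      exact ⟨rfl, hη⟩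
    obtain ⟨m, hm, hmη⟩ := h1
    have h2 : pairing (J₁ n) (J₀ m) = pairing A (J₀ m) := hn' m hm
    rw [hmη, ← sub_eq_zero, ← pairing_sub_left] at h2
    simp [pairing] at h2
    simp only [Prod.fst_sub, map_sub]
    linarith
  refine ⟨n.2, (v, (A - J₁ n).2), hn.2, ?_⟩
  rw [← hn2, includeGT_apply, hv]
  exact (sub_add_cancel A (J₁ n)).symm

/-- By induction on the number of factors, all Clifford products applied to φ pull back to zero: a
factor in V ⊕ W* is harmless, and a factor J₁n can be traded for the conormal n. -/
theorem pullForm_ne_zero {f : V →L[ℝ] W} {J₀ J₁ : GT W →ₗ[ℝ] GT W}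
    (h : IsKaehlerPair J₀ J₁) (hN : (conormal f).map J₀ = conormal f) {φ : MixedForm W}
    (hφ : φ ≠ 0) (hker : eigenL J₁ = spinorKer φ) : pullForm f φ ≠ 0 := by
  intro h0
  have hmem : ∀ n, φ ∈ pullKer f n := by
    intro n
    induction n with
    | zero => exact mem_pullKer_zero.2 h0
    | succ n ih =>
      refine mem_pullKer_succ.2 ⟨ih, fun A => ?_⟩
      obtain ⟨η, c, hη, rfl⟩ := exists_sub_mem h hN A
      rw [map_add]
      refine Submodule.add_mem _ (clifford_include_mem_pullKer ih c) ?_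
      -- The eigenvector with real part J₁n is J₁n - i n; it kills φ, so J₁n · φ = i (n · φ).
      have h1 : cx (J₁ (0, η)) (-((0, η) : GT W)) ∈ spinorKer φ := by
        rw [← hker, cx_mem_eigenL_of_sq h.sq₁, h.sq₁]
      rw [cx_mem_spinorKer] at h1
      rw [eq_neg_of_add_eq_zero_left h1, map_neg]
      have h2 : ((0, η) : GT W) = includeGT f (0, η) := by simp
      rw [h2]
      exact Submodule.neg_mem _ (Submodule.smul_mem _ _
        (Submodule.neg_mem _ (clifford_include_mem_pullKer ih _)))
  exact hφ (funext fun n => apply_eq_zero_of_mem_pullKer (hmem n))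

/-- The kernel of a nonzero form is isotropic. -/
theorem pairing_of_mem_spinorKer {φ : MixedForm V} (hφ : φ ≠ 0) {a b c d : GT V}
    (h1 : cx a b ∈ spinorKer φ) (h2 : cx c d ∈ spinorKer φ) :
    pairing a c = pairing b d ∧ pairing a d = -pairing b c := by
  rw [cx_mem_spinorKer] at h1 h2
  set P : GT V → MixedForm V →ₗ[ℂ] MixedForm V := cliffordAction with hP
  have hanti : ∀ A B : GT V, P A (P B φ) + P B (P A φ) = ((2 * pairing A B : ℝ) : ℂ) • φ := by
    intro A B
    rw [hP]
    refine (clifford_anticomm A B φ).trans ?_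
    funext k
    ext v
    simp
  have e1 : P a φ + Complex.I • P b φ = 0 := h1
  have e2 : P c φ + Complex.I • P d φ = 0 := h2
  -- Each of the two elements is applied to the relation killing φ by the other. The sum is twice
  -- the complex bilinear pairing times φ, and φ is nonzero.
  have f1 := congrArg (fun x => P c x + Complex.I • P d x) e1
  have f2 := congrArg (fun x => P a x + Complex.I • P b x) e2
  simp only [map_add, map_smul, map_zero, smul_zero, add_zero, smul_add, smul_smul,
    Complex.I_mul_I] at f1 f2
  have key : ((((2 * pairing a c : ℝ) : ℂ) - ((2 * pairing b d : ℝ) : ℂ)) +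
      Complex.I * (((2 * pairing a d : ℝ) : ℂ) + ((2 * pairing b c : ℝ) : ℂ))) • φ = 0 := by
    have h1 := hanti a c
    have h2 := hanti b d
    have h3 := hanti a d
    have h4 := hanti b c
    rw [add_smul, sub_smul, mul_smul, add_smul, ← h1, ← h2, ← h3, ← h4]
    linear_combination (norm := module) f1 + f2
  have hz := (smul_eq_zero.1 key).resolve_right hφ
  have hre := congrArg Complex.re hz
  have him := congrArg Complex.im hz
  simp at hre him
  constructor <;> linarith

/-- The eigenspace of K₁ lies in the kernel by naturality of the Clifford action. Isotropy of the
kernel, tested against the eigenvectors C + i K₁C, forces any a + ib in it to satisfy K₁a = b. -/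
theorem spinorKer_pullForm {f : V →L[ℝ] W} {J₁ : GT W →ₗ[ℝ] GT W} {K₁ : GT V →ₗ[ℝ] GT V}
    {φ : MixedForm W} (hker : eigenL J₁ = spinorKer φ) (h0 : pullForm f φ ≠ 0)
    (hK : eigenL K₁ = restrictSubspace f (eigenL J₁)) (hsq : ∀ A, K₁ (K₁ A) = -A)
    (horth : ∀ A B, pairing (K₁ A) (K₁ B) = pairing A B) :
    eigenL K₁ = spinorKer (pullForm f φ) := by
  have hle : eigenL K₁ ≤ spinorKer (pullForm f φ) := by
    rw [hK, restrictSubspace, Submodule.map_le_iff_le_comap]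
    intro x hx
    obtain ⟨a, b, rfl⟩ := exists_cx x
    rw [Submodule.mem_comap, baseChange_cx, hker, cx_mem_spinorKer] at hx
    rw [Submodule.mem_comap, baseChange_cx, cx_mem_spinorKer, ← pullForm_clifford,
      ← pullForm_clifford, ← map_smul, ← map_add, hx, map_zero]
  refine le_antisymm hle fun x hx => ?_
  obtain ⟨a, b, rfl⟩ := exists_cx x
  rw [cx_mem_eigenL_of_sq hsq]
  refine eq_of_pairing fun C => ?_
  have h1 := pairing_of_mem_spinorKer h0 hx (hle ((cx_mem_eigenL_of_sq hsq C (K₁ C)).2 rfl))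
  have h2 : pairing (K₁ a) C = -pairing a (K₁ C) := by
    rw [← horth a (K₁ C), hsq, pairing_neg_right, neg_neg]
  rw [h2, h1.2, neg_neg]

end

/-! ### Smooth dependence of the orthogonal lift on the point. -/

section

variable {E : Type*} [NormedAddCommGroup E] [NormedSpace ℝ E]
  {F : Type*} [NormedAddCommGroup F] [NormedSpace ℝ F]

/-- `includeGT` as a continuous linear map. -/
def includeCLM (f : F →L[ℝ] E) : (F × (E →L[ℝ] ℝ)) →L[ℝ] GT E :=
  f.prodMap (ContinuousLinearMap.id ℝ (E →L[ℝ] ℝ))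

/-- `restrictGT` as a continuous linear map. -/
def restrictCLM (f : F →L[ℝ] E) : (F × (E →L[ℝ] ℝ)) →L[ℝ] GT F :=
  (ContinuousLinearMap.id ℝ F).prodMap (ContinuousLinearMap.precomp ℝ f)

theorem includeCLM_apply (f : F →L[ℝ] E) (a : F × (E →L[ℝ] ℝ)) :
    includeCLM f a = includeGT f a := rfl

theorem restrictCLM_apply (f : F →L[ℝ] E) (a : F × (E →L[ℝ] ℝ)) :
    restrictCLM f a = restrictGT f a := rfl

/-- The pairing as a continuous bilinear form. -/
def pairingCLM (E : Type*) [NormedAddCommGroup E] [NormedSpace ℝ E] :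
    GT E →L[ℝ] GT E →L[ℝ] ℝ :=
  (1 / 2 : ℝ) • (ContinuousLinearMap.precomp ℝ (ContinuousLinearMap.fst ℝ E (E →L[ℝ] ℝ)) ∘L
      ContinuousLinearMap.snd ℝ E (E →L[ℝ] ℝ) +
    (ContinuousLinearMap.precomp ℝ (ContinuousLinearMap.fst ℝ E (E →L[ℝ] ℝ)) ∘L
      ContinuousLinearMap.snd ℝ E (E →L[ℝ] ℝ)).flip)

@[simp] theorem pairingCLM_apply (A B : GT E) : pairingCLM E A B = pairing A B := by
  simp [pairingCLM, pairing]
  ring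

theorem isInvertible_of_injective {U U' : Type*} [NormedAddCommGroup U] [NormedSpace ℝ U]
    [NormedAddCommGroup U'] [NormedSpace ℝ U'] [FiniteDimensional ℝ U] [FiniteDimensional ℝ U']
    (hd : Module.finrank ℝ U = Module.finrank ℝ U') {L : U →L[ℝ] U'}
    (hL : Function.Injective L) : L.IsInvertible := by
  refine ⟨(LinearEquiv.ofInjectiveOfFinrankEq (L : U →ₗ[ℝ] U') hL hd).toContinuousLinearEquiv, ?_⟩
  ext u
  rfl

theorem finrank_clm_real (U : Type*) [NormedAddCommGroup U] [NormedSpace ℝ U]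
    [FiniteDimensional ℝ U] : Module.finrank ℝ U = Module.finrank ℝ (U →L[ℝ] ℝ) := by
  rw [← (LinearMap.toContinuousLinearMap (𝕜 := ℝ) (E := U) (F' := ℝ)).finrank_eq]
  exact Subspace.dual_finrank_eq.symm

/-- The restriction to `F ⊕ E*` of the (negative) metric of a Kähler pair. -/
def metricCLM (f : F →L[ℝ] E) (J₀ J₁ : GT E →L[ℝ] GT E) :
    (F × (E →L[ℝ] ℝ)) →L[ℝ] (F × (E →L[ℝ] ℝ)) →L[ℝ] ℝ :=
  (ContinuousLinearMap.precomp ℝ (includeCLM f)) ∘L pairingCLM E ∘L J₀ ∘L J₁ ∘L includeCLM f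

theorem metricCLM_apply (f : F →L[ℝ] E) (J₀ J₁ : GT E →L[ℝ] GT E) (a b : F × (E →L[ℝ] ℝ)) :
    metricCLM f J₀ J₁ a b = pairing (J₀ (J₁ (includeGT f a))) (includeGT f b) := by
  simp [metricCLM, includeCLM_apply]

/-- The metric on `(F ⊕ F*)*` induced by the metric on `F ⊕ E*`. -/
def dualMetricCLM (f : F →L[ℝ] E) (J₀ J₁ : GT E →L[ℝ] GT E) :
    (GT F →L[ℝ] ℝ) →L[ℝ] GT F :=
  restrictCLM f ∘L (metricCLM f J₀ J₁).inverse ∘L ContinuousLinearMap.precomp ℝ (restrictCLM f)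

/-- The orthogonal lift of `F ⊕ F*` to `E ⊕ E*`. -/
def liftCLM (f : F →L[ℝ] E) (J₀ J₁ : GT E →L[ℝ] GT E) : GT F →L[ℝ] GT E :=
  includeCLM f ∘L (metricCLM f J₀ J₁).inverse ∘L ContinuousLinearMap.precomp ℝ (restrictCLM f) ∘L
    (dualMetricCLM f J₀ J₁).inverse

variable [FiniteDimensional ℝ E] [FiniteDimensional ℝ F]
variable {f : F →L[ℝ] E} {J₀ J₁ : GT E →L[ℝ] GT E}

theorem metricCLM_isInvertible (hf : Function.Injective f)
    (h : IsKaehlerPair (J₀ : GT E →ₗ[ℝ] GT E) (J₁ : GT E →ₗ[ℝ] GT E)) :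
    (metricCLM f J₀ J₁).IsInvertible := by
  refine isInvertible_of_injective (finrank_clm_real _)
    ((injective_iff_map_eq_zero _).2 fun a ha => ?_)
  have h1 : metricCLM f J₀ J₁ a a = 0 := by rw [ha]; rfl
  rw [metricCLM_apply] at h1
  have h2 := h.eq_zero h1
  rw [includeGT_apply, Prod.mk_eq_zero] at h2
  exact Prod.ext (hf (h2.1.trans (map_zero f).symm)) h2.2

/-- If θ is in the kernel, the vector a representing the pullback of θ restricts to zero, so its
norm g(a, a) = θ(r a) vanishes. Then a = 0, and θ = 0 since the restriction r is onto. -/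
theorem dualMetricCLM_isInvertible (hf : Function.Injective f)
    (h : IsKaehlerPair (J₀ : GT E →ₗ[ℝ] GT E) (J₁ : GT E →ₗ[ℝ] GT E)) :
    (dualMetricCLM f J₀ J₁).IsInvertible := by
  refine isInvertible_of_injective (finrank_clm_real _).symm
    ((injective_iff_map_eq_zero _).2 fun θ hθ => ?_)
  set g := metricCLM f J₀ J₁ with hg
  set a := g.inverse (θ ∘L restrictCLM f) with ha
  have hga : g a = θ ∘L restrictCLM f := (metricCLM_isInvertible hf h).self_apply_inverse _
  have hra : restrictCLM f a = 0 := hθ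
  have h1 : g a a = 0 := by
    rw [hga, ContinuousLinearMap.comp_apply, hra, map_zero]
  rw [hg, metricCLM_apply] at h1
  have h2 := h.eq_zero h1
  rw [includeGT_apply, Prod.mk_eq_zero] at h2
  have h3 : a = 0 := Prod.ext (hf (h2.1.trans (map_zero f).symm)) h2.2
  rw [h3, map_zero] at hga
  refine ContinuousLinearMap.ext fun A => ?_
  obtain ⟨η, hη⟩ := exists_comp_eq f hf A.2
  have h4 : restrictCLM f (A.1, η) = A := Prod.ext rfl hη
  rw [← h4]
  exact (DFunLike.congr_fun hga (A.1, η)).symm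

/-- With S = r g⁻¹ r*, the vector g⁻¹ r* S⁻¹ A restricts to A, and its g-product with an element of
ker r is S⁻¹A evaluated at 0. -/
theorem isLift_liftCLM (hf : Function.Injective f)
    (h : IsKaehlerPair (J₀ : GT E →ₗ[ℝ] GT E) (J₁ : GT E →ₗ[ℝ] GT E)) :
    IsLift f (J₀ : GT E →ₗ[ℝ] GT E) (J₁ : GT E →ₗ[ℝ] GT E)
      (liftCLM f J₀ J₁ : GT F →ₗ[ℝ] GT E) := by
  set g := metricCLM f J₀ J₁ with hg
  set S := dualMetricCLM f J₀ J₁ with hS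
  have key : ∀ A : GT F, restrictGT f (g.inverse (S.inverse A ∘L restrictCLM f)) = A := by
    intro A
    exact (dualMetricCLM_isInvertible hf h).self_apply_inverse A
  refine ⟨fun A => ?_, fun A => ?_, fun A η hη => ?_⟩
  · exact congrArg f (congrArg Prod.fst (key A))
  · exact congrArg Prod.snd (key A)
  · have h1 : g (g.inverse (S.inverse A ∘L restrictCLM f)) (0, η) = 0 := by
      rw [(metricCLM_isInvertible hf h).self_apply_inverse, ContinuousLinearMap.comp_apply,
        restrictCLM_apply, restrictGT_apply, hη]
      exact map_zero _
    rw [hg, metricCLM_apply] at h1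
    rw [show ((0, η) : GT E) = includeGT f (0, η) by simp]
    exact h1

variable {G : Type*} [NormedAddCommGroup G] [NormedSpace ℝ G] {n : WithTop ℕ∞}

theorem contDiffAt_clm_precomp {U U' : Type*} [NormedAddCommGroup U] [NormedSpace ℝ U]
    [NormedAddCommGroup U'] [NormedSpace ℝ U'] {T : G → U →L[ℝ] U'} {y : G}
    (hT : ContDiffAt ℝ n T y) :
    ContDiffAt ℝ n (fun z => (ContinuousLinearMap.precomp ℝ (T z) : (U' →L[ℝ] ℝ) →L[ℝ] _)) y :=
  (ContinuousLinearMap.compL ℝ U U' ℝ).flip.contDiff.contDiffAt.comp y hT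

theorem contDiffAt_clm_prodMap {U₁ U₂ U₃ U₄ : Type*} [NormedAddCommGroup U₁] [NormedSpace ℝ U₁]
    [NormedAddCommGroup U₂] [NormedSpace ℝ U₂] [NormedAddCommGroup U₃] [NormedSpace ℝ U₃]
    [NormedAddCommGroup U₄] [NormedSpace ℝ U₄]
    {T : G → U₁ →L[ℝ] U₂} {T' : G → U₃ →L[ℝ] U₄} {y : G}
    (hT : ContDiffAt ℝ n T y) (hT' : ContDiffAt ℝ n T' y) :
    ContDiffAt ℝ n (fun z => (T z).prodMap (T' z)) y :=
  (ContinuousLinearMap.prodMapL ℝ U₁ U₂ U₃ U₄).contDiff.contDiffAt.comp y (hT.prodMk hT')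

theorem contDiffAt_clm_inverse {U U' : Type*} [NormedAddCommGroup U] [NormedSpace ℝ U]
    [CompleteSpace U] [NormedAddCommGroup U'] [NormedSpace ℝ U'] {T : G → U →L[ℝ] U'} {y : G}
    (hT : ContDiffAt ℝ n T y) (hinv : (T y).IsInvertible) :
    ContDiffAt ℝ n (fun z => (T z).inverse) y :=
  ContDiffAt.comp (g := ContinuousLinearMap.inverse) y hinv.contDiffAt_map_inverse hT

theorem contDiffAt_includeCLM {T : G → F →L[ℝ] E} {y : G} (hT : ContDiffAt ℝ n T y) :
    ContDiffAt ℝ n (fun z => includeCLM (T z)) y :=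
  contDiffAt_clm_prodMap hT contDiffAt_const

theorem contDiffAt_restrictCLM {T : G → F →L[ℝ] E} {y : G} (hT : ContDiffAt ℝ n T y) :
    ContDiffAt ℝ n (fun z => restrictCLM (T z)) y :=
  contDiffAt_clm_prodMap contDiffAt_const (contDiffAt_clm_precomp hT)

/-- Unlike the section chosen in `exists_isLift`, this lift is a composition of smooth maps and
inverses of invertible ones. -/
theorem contDiffAt_liftCLM {T : G → F →L[ℝ] E} {J₀ J₁ : G → GT E →L[ℝ] GT E} {y : G}
    (hT : ContDiffAt ℝ n T y) (h₀ : ContDiffAt ℝ n J₀ y) (h₁ : ContDiffAt ℝ n J₁ y)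
    (hinj : Function.Injective (T y))
    (h : IsKaehlerPair (J₀ y : GT E →ₗ[ℝ] GT E) (J₁ y : GT E →ₗ[ℝ] GT E)) :
    ContDiffAt ℝ n (fun z => liftCLM (T z) (J₀ z) (J₁ z)) y := by
  have hi := contDiffAt_includeCLM hT
  have hr := contDiffAt_clm_precomp (contDiffAt_restrictCLM hT)
  have hg : ContDiffAt ℝ n (fun z => metricCLM (T z) (J₀ z) (J₁ z)) y :=
    (contDiffAt_clm_precomp hi).clm_comp
      (contDiffAt_const.clm_comp (h₀.clm_comp (h₁.clm_comp hi)))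
  have hg' : ContDiffAt ℝ n (fun z => (metricCLM (T z) (J₀ z) (J₁ z)).inverse) y :=
    contDiffAt_clm_inverse hg (metricCLM_isInvertible hinj h)
  have hS : ContDiffAt ℝ n (fun z => dualMetricCLM (T z) (J₀ z) (J₁ z)) y :=
    (contDiffAt_restrictCLM hT).clm_comp (hg'.clm_comp hr)
  have hS' : ContDiffAt ℝ n (fun z => (dualMetricCLM (T z) (J₀ z) (J₁ z)).inverse) y :=
    contDiffAt_clm_inverse hS (dualMetricCLM_isInvertible hinj h)
  exact hi.clm_comp (hg'.clm_comp (hr.clm_comp hS'))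

theorem pairingCLM_isInvertible : (pairingCLM E).IsInvertible := by
  refine isInvertible_of_injective (finrank_clm_real _)
    ((injective_iff_map_eq_zero _).2 fun A hA => eq_zero_of_pairing fun B => ?_)
  rw [← pairingCLM_apply, hA]
  rfl

/-- An endomorphism field that corresponds under an isometric lift to a smooth one is smooth. -/
theorem contDiffAt_of_lift {τ : G → GT F →L[ℝ] GT E} {J : G → GT E →L[ℝ] GT E}
    {JM : G → GT F →L[ℝ] GT F} {y : G} (hτ : ContDiffAt ℝ n τ y) (hJ : ContDiffAt ℝ n J y)
    (hpair : ∀ᶠ z in nhds y, ∀ A B, pairing (τ z A) (τ z B) = pairing A B)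
    (hJM : ∀ᶠ z in nhds y, ∀ A, J z (τ z A) = τ z (JM z A)) : ContDiffAt ℝ n JM y := by
  -- With P the pairing as a map to the dual, τ* P τ = P, so JM = P⁻¹ τ* P J τ, an expression free
  -- of any left inverse of τ.
  have h1 : ContDiffAt ℝ n (fun z => (pairingCLM F).inverse ∘L
      (ContinuousLinearMap.precomp ℝ (τ z)) ∘L pairingCLM E ∘L J z ∘L τ z) y :=
    contDiffAt_const.clm_comp ((contDiffAt_clm_precomp hτ).clm_comp
      (contDiffAt_const.clm_comp (hJ.clm_comp hτ)))
  refine h1.congr_of_eventuallyEq ?_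
  filter_upwards [hpair, hJM] with z hz hz'
  refine ContinuousLinearMap.ext fun A => ?_
  have h2 : (ContinuousLinearMap.precomp ℝ (τ z)) (pairingCLM E (J z (τ z A))) =
      pairingCLM F (JM z A) := by
    ext B
    all_goals simp [hz', hz]
  simp only [ContinuousLinearMap.comp_apply]
  rw [h2, pairingCLM_isInvertible.inverse_apply_self]

end

/-! ### The Courant bracket and involutivity under immersions. -/

section

variable {E : Type*} [NormedAddCommGroup E] [NormedSpace ℝ E]
  {F : Type*} [NormedAddCommGroup F] [NormedSpace ℝ F]

/-- `B ∈ V ⊕ W*` (for `f : V → W`) is mapped to `A ∈ V ⊕ V*` by restriction of covectors. -/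
def IsRelated (f : F →L[ℝ] E) (A : GT F) (B : GT E) : Prop :=
  B.1 = f A.1 ∧ B.2.comp f = A.2

theorem IsRelated.add {f : F →L[ℝ] E} {A A' : GT F} {B B' : GT E} (h : IsRelated f A B)
    (h' : IsRelated f A' B') : IsRelated f (A + A') (B + B') :=
  ⟨by simp [h.1, h'.1], by simp [← h.2, ← h'.2]⟩

theorem IsRelated.sub {f : F →L[ℝ] E} {A A' : GT F} {B B' : GT E} (h : IsRelated f A B)
    (h' : IsRelated f A' B') : IsRelated f (A - A') (B - B') :=
  ⟨by simp [h.1, h'.1], by simp [← h.2, ← h'.2, ContinuousLinearMap.sub_comp]⟩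

theorem Induces.apply_related {f : F →L[ℝ] E} {J : GT E →ₗ[ℝ] GT E} {JM : GT F →ₗ[ℝ] GT F}
    (hJ : Induces f J JM) {A A' : GT F} {B B' : GT E} (h : IsRelated f A B)
    (h' : IsRelated f A' B') (hB : J B = B') : JM A = A' := by
  have e1 : includeGT f (A.1, B.2) = B := Prod.ext h.1.symm rfl
  have e2 : includeGT f (A'.1, B'.2) = B' := Prod.ext h'.1.symm rfl
  have e3 : restrictGT f (A.1, B.2) = A := Prod.ext rfl h.2
  have e4 : restrictGT f (A'.1, B'.2) = A' := Prod.ext rfl h'.2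
  rw [← e3, ← e4]
  exact hJ _ _ (by rw [e1, e2, hB])

variable {ι : F → E} {y : F}

theorem fderiv_related_vector (hι : ContDiffAt ℝ ∞ ι y) {u : F → F} {u' : E → E}
    (hu : DifferentiableAt ℝ u y) (hu' : DifferentiableAt ℝ u' (ι y))
    (h : ∀ᶠ z in nhds y, u' (ι z) = fderiv ℝ ι z (u z)) (w : F) :
    fderiv ℝ u' (ι y) (fderiv ℝ ι y w) =
      fderiv ℝ (fderiv ℝ ι) y w (u y) + fderiv ℝ ι y (fderiv ℝ u y w) := by
  have hT : DifferentiableAt ℝ (fderiv ℝ ι) y :=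
    (hι.fderiv_right (m := ∞) (by simp)).differentiableAt (by simp)
  have h1 := (hu'.hasFDerivAt.comp y (hι.differentiableAt (by simp)).hasFDerivAt)
  have h2 := (hT.hasFDerivAt.clm_apply hu.hasFDerivAt).congr_of_eventuallyEq
    (f₁ := u' ∘ ι) h
  have := DFunLike.congr_fun (h1.unique h2) w
  simpa [add_comm] using this

theorem fderiv_related_covector (hι : ContDiffAt ℝ ∞ ι y) {η : F → F →L[ℝ] ℝ}
    {η' : E → E →L[ℝ] ℝ}
    (hη : DifferentiableAt ℝ η y) (hη' : DifferentiableAt ℝ η' (ι y))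
    (h : ∀ᶠ z in nhds y, (η' (ι z)).comp (fderiv ℝ ι z) = η z) (w v : F) :
    fderiv ℝ η y w v = fderiv ℝ η' (ι y) (fderiv ℝ ι y w) (fderiv ℝ ι y v) +
      η' (ι y) (fderiv ℝ (fderiv ℝ ι) y w v) := by
  have hT : DifferentiableAt ℝ (fderiv ℝ ι) y :=
    (hι.fderiv_right (m := ∞) (by simp)).differentiableAt (by simp)
  have h1 := (hη'.hasFDerivAt.comp y (hι.differentiableAt (by simp)).hasFDerivAt)
  have h2 := (h1.clm_comp hT.hasFDerivAt).congr_of_eventuallyEq (f₁ := η)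
    (h.mono fun z hz => hz.symm)
  have := DFunLike.congr_fun (DFunLike.congr_fun (hη.hasFDerivAt.unique h2) w) v
  simpa [add_comm] using this

/-- The term in the second derivative of ι is symmetric and drops out of dη. -/
theorem contractD_related (hι : ContDiffAt ℝ ∞ ι y) {η : F → F →L[ℝ] ℝ}
    {η' : E → E →L[ℝ] ℝ} {u : F → F} {u' : E → E}
    (hη : DifferentiableAt ℝ η y) (hη' : DifferentiableAt ℝ η' (ι y))
    (h : ∀ᶠ z in nhds y, (η' (ι z)).comp (fderiv ℝ ι z) = η z)
    (hu : u' (ι y) = fderiv ℝ ι y (u y)) :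
    (contractD u' η' (ι y)).comp (fderiv ℝ ι y) = contractD u η y := by
  have hs : IsSymmSndFDerivAt ℝ ι y := hι.isSymmSndFDerivAt
    (by rw [minSmoothness_of_isRCLikeNormedField]; exact WithTop.coe_le_coe.2 le_top)
  ext v
  simp only [contractD, ContinuousLinearMap.comp_apply, sub_apply,
    ContinuousLinearMap.flip_apply, hu]
  rw [fderiv_related_covector hι hη hη' h, fderiv_related_covector hι hη hη' h, hs.eq (u y) v]
  ring

theorem lieDerivForm_related (hι : ContDiffAt ℝ ∞ ι y) {η : F → F →L[ℝ] ℝ}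
    {η' : E → E →L[ℝ] ℝ} {u : F → F} {u' : E → E}
    (hη : DifferentiableAt ℝ η y) (hη' : DifferentiableAt ℝ η' (ι y))
    (hu' : DifferentiableAt ℝ u' (ι y))
    (h : ∀ᶠ z in nhds y, (η' (ι z)).comp (fderiv ℝ ι z) = η z)
    (hu : ∀ᶠ z in nhds y, u' (ι z) = fderiv ℝ ι z (u z)) :
    (lieDerivForm u' η' (ι y)).comp (fderiv ℝ ι y) = lieDerivForm u η y := by
  have h1 : (fun z => η z (u z)) =ᶠ[nhds y] (fun x => η' x (u' x)) ∘ ι := by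
    filter_upwards [h, hu] with z hz hz'
    rw [← hz]
    simp [hz']
  have h2 : fderiv ℝ (fun z => η z (u z)) y =
      (fderiv ℝ (fun x => η' x (u' x)) (ι y)).comp (fderiv ℝ ι y) := by
    rw [h1.fderiv_eq, fderiv_comp y (hη'.clm_apply hu') (hι.differentiableAt (by simp))]
  rw [lieDerivForm, lieDerivForm, ContinuousLinearMap.add_comp, h2,
    contractD_related hι hη hη' h hu.self_of_nhds]

/-- The Courant bracket is compatible with restriction to submanifolds. -/
theorem courant_related (hι : ContDiffAt ℝ ∞ ι y) {A B : F → GT F} {A' B' : E → GT E}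
    (hA : DifferentiableAt ℝ A y) (hB : DifferentiableAt ℝ B y)
    (hA' : DifferentiableAt ℝ A' (ι y)) (hB' : DifferentiableAt ℝ B' (ι y))
    (hAA' : ∀ᶠ z in nhds y, IsRelated (fderiv ℝ ι z) (A z) (A' (ι z)))
    (hBB' : ∀ᶠ z in nhds y, IsRelated (fderiv ℝ ι z) (B z) (B' (ι z))) :
    IsRelated (fderiv ℝ ι y) (courant A B y) (courant A' B' (ι y)) := by
  have hs : IsSymmSndFDerivAt ℝ ι y := hι.isSymmSndFDerivAt
    (by rw [minSmoothness_of_isRCLikeNormedField]; exact WithTop.coe_le_coe.2 le_top)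
  have a1 := hAA'.mono fun z hz => hz.1
  have a2 := hAA'.mono fun z hz => hz.2
  have b1 := hBB'.mono fun z hz => hz.1
  have b2 := hBB'.mono fun z hz => hz.2
  constructor
  · simp only [courant, VectorField.lieBracket]
    -- The second derivative of ι enters once for each order of the two vectors and cancels by
    -- symmetry.
    rw [a1.self_of_nhds, b1.self_of_nhds, fderiv_related_vector hι hB.fst hB'.fst b1,
      fderiv_related_vector hι hA.fst hA'.fst a1, map_sub, hs.eq (A y).1 (B y).1]
    abel
  · simp only [courant]
    rw [ContinuousLinearMap.smul_comp, ContinuousLinearMap.add_comp, ContinuousLinearMap.sub_comp,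
      ContinuousLinearMap.sub_comp, lieDerivForm_related hι hB.snd hB'.snd hA'.fst b2 a1,
      lieDerivForm_related hι hA.snd hA'.snd hB'.fst a2 b1,
      contractD_related (u := fun z => (B z).1) hι hA.snd hA'.snd a2 b1.self_of_nhds,
      contractD_related (u := fun z => (A z).1) hι hB.snd hB'.snd b2 a1.self_of_nhds]

/-- Immersions have smooth local left inverses. -/
theorem exists_local_retraction [FiniteDimensional ℝ E] [FiniteDimensional ℝ F] {U : Set F}
    (hU : IsOpen U) (hy : y ∈ U) (hι : ContDiffOn ℝ ∞ ι U)
    (hinj : Function.Injective (fderiv ℝ ι y)) :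
    ∃ r : E → F, (∀ᶠ x in nhds (ι y), ContDiffAt ℝ ∞ r x) ∧ ∀ᶠ z in nhds y, r (ι z) = z := by
  -- For a linear left inverse R of the derivative of ι at y, the map R ∘ ι has derivative the
  -- identity there. The inverse function theorem applies, and r is its local inverse after R.
  obtain ⟨R, hR⟩ := LinearMap.exists_leftInverse_of_injective (fderiv ℝ ι y : F →ₗ[ℝ] E)
    (LinearMap.ker_eq_bot.2 hinj)
  let R' : E →L[ℝ] F := LinearMap.toContinuousLinearMap R
  have hφ : ContDiffOn ℝ ∞ (R' ∘ ι) U := R'.contDiff.comp_contDiffOn hι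
  have hφy : ContDiffAt ℝ ∞ (R' ∘ ι) y := hφ.contDiffAt (hU.mem_nhds hy)
  have hder : fderiv ℝ (R' ∘ ι) y = (ContinuousLinearEquiv.refl ℝ F : F →L[ℝ] F) := by
    rw [fderiv_comp y R'.differentiableAt
      ((hι.contDiffAt (hU.mem_nhds hy)).differentiableAt (by simp)), R'.fderiv]
    ext v
    exact LinearMap.congr_fun hR v
  have hstrict : HasFDerivAt (R' ∘ ι) (ContinuousLinearEquiv.refl ℝ F : F →L[ℝ] F) y := by
    rw [← hder]
    exact (hφy.differentiableAt (by simp)).hasFDerivAt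
  let h := hφy.toOpenPartialHomeomorph (R' ∘ ι) hstrict (by simp)
  have hcoe : ⇑h = R' ∘ ι := hφy.toOpenPartialHomeomorph_coe hstrict (by simp)
  have hys : y ∈ h.source := hφy.mem_toOpenPartialHomeomorph_source hstrict (by simp)
  have hyt : R' (ι y) ∈ h.target := hφy.image_mem_toOpenPartialHomeomorph_target hstrict (by simp)
  have hsy : h.symm (R' (ι y)) = y := by
    have := h.left_inv hys
    rwa [hcoe] at this
  refine ⟨h.symm ∘ R', ?_, ?_⟩
  · have hcont : ContinuousAt (fderiv ℝ (R' ∘ ι)) y :=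
      (hφy.fderiv_right (m := ∞) (by simp)).continuousAt
    -- Smoothness of r is needed on a neighbourhood, not only at ι y. The derivative of R ∘ ι stays
    -- invertible nearby because invertible maps form an open set.
    have hev : ∀ᶠ z in nhds y, z ∈ U ∧ fderiv ℝ (R' ∘ ι) z ∈
        Set.range ((↑) : (F ≃L[ℝ] F) → F →L[ℝ] F) := by
      refine (hU.eventually_mem hy).and (hcont ?_)
      rw [hder]
      exact ContinuousLinearEquiv.nhds _
    have hev2 : ∀ᶠ x in nhds (R' (ι y)), x ∈ h.target ∧ h.symm x ∈ U ∧
        fderiv ℝ (R' ∘ ι) (h.symm x) ∈ Set.range ((↑) : (F ≃L[ℝ] F) → F →L[ℝ] F) := by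
      refine (h.open_target.eventually_mem hyt).and ?_
      have hc := h.continuousAt_symm hyt
      rw [ContinuousAt, hsy] at hc
      exact hc hev
    filter_upwards [R'.continuous.continuousAt.eventually hev2] with x hx
    obtain ⟨hxt, hxU, f', hf'⟩ := hx
    have hz : ContDiffAt ℝ ∞ (R' ∘ ι) (h.symm (R' x)) := hφ.contDiffAt (hU.mem_nhds hxU)
    have h1 : ContDiffAt ℝ ∞ h.symm (R' x) := by
      refine h.contDiffAt_symm (f₀' := f') hxt ?_ (by rw [hcoe]; exact hz)
      rw [hcoe, hf']
      exact (hz.differentiableAt (by simp)).hasFDerivAt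
    exact h1.comp x R'.contDiff.contDiffAt
  · filter_upwards [h.open_source.mem_nhds hys] with z hz
    have := h.left_inv hz
    rwa [hcoe] at this

theorem isInvolutiveOn_of_local {L : F → Submodule ℂ (ℂ ⊗[ℝ] GT F)} {S : Set F}
    (h : ∀ y ∈ S, ∃ U : Set F, IsOpen U ∧ y ∈ U ∧ IsInvolutiveOn L U) : IsInvolutiveOn L S := by
  intro U hU hUS A₁ B₁ A₂ B₂ hA₁ hB₁ hA₂ hB₂ h1 h2 y hy
  obtain ⟨U', hU', hyU', hL⟩ := h y (hUS hy)
  have hsub : U ∩ U' ⊆ U := Set.inter_subset_left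
  exact hL (U ∩ U') (hU.inter hU') Set.inter_subset_right A₁ B₁ A₂ B₂ (hA₁.mono hsub)
    (hB₁.mono hsub) (hA₂.mono hsub) (hB₂.mono hsub) (fun z hz => h1 z hz.1)
    (fun z hz => h2 z hz.1) y ⟨hy, hyU'⟩

/-- A section A + iB of the eigenbundle is lifted by τ and spread off the image by a local
retraction r. The extensions are sections of L_J on an open set, so their bracket lies in L_J; it is
related to the original bracket, and `Induces` brings the conclusion down. -/
theorem isInvolutiveOn_induced [FiniteDimensional ℝ E] [FiniteDimensional ℝ F] {U : Set F}
    {S : Set E} (hU : IsOpen U) (hS : IsOpen S) (hι : ContDiffOn ℝ ∞ ι U) (hUS : Set.MapsTo ι U S)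
    (hinj : ∀ z ∈ U, Function.Injective (fderiv ℝ ι z))
    {J : E → GT E →L[ℝ] GT E} {JM : F → GT F →L[ℝ] GT F} {τ : F → GT F →L[ℝ] GT E}
    (hJ : ContDiffOn ℝ ∞ J S) (hτ : ∀ z ∈ U, ContDiffAt ℝ ∞ τ z)
    (hsq : ∀ x ∈ S, ∀ A, J x (J x A) = -A) (hsqM : ∀ z ∈ U, ∀ A, JM z (JM z A) = -A)
    (hτrel : ∀ z ∈ U, ∀ A, IsRelated (fderiv ℝ ι z) A (τ z A))
    (hτJ : ∀ z ∈ U, ∀ A, J (ι z) (τ z A) = τ z (JM z A))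
    (hind : ∀ z ∈ U, Induces (fderiv ℝ ι z) (J (ι z) : GT E →ₗ[ℝ] GT E)
      (JM z : GT F →ₗ[ℝ] GT F))
    (hinv : IsInvolutiveOn (fun x => eigenL (J x : GT E →ₗ[ℝ] GT E)) S) :
    IsInvolutiveOn (fun z => eigenL (JM z : GT F →ₗ[ℝ] GT F)) U := by
  intro U' hU' hU'U A₁ B₁ A₂ B₂ hA₁ hB₁ hA₂ hB₂ h1 h2 y hy
  have hB : ∀ A B : F → GT F,
      (∀ z ∈ U', cx (A z) (B z) ∈ eigenL (JM z : GT F →ₗ[ℝ] GT F)) →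
      ∀ z ∈ U', JM z (A z) = B z := fun A B h z hz =>
    (cx_mem_eigenL_of_sq (fun C => hsqM z (hU'U hz) C) _ _).1 (h z hz)
  replace h1 := hB _ _ h1
  replace h2 := hB _ _ h2
  obtain ⟨r, hr, hrι⟩ := exists_local_retraction hU (hU'U hy) hι (hinj y (hU'U hy))
  have hry : r (ι y) = y := hrι.self_of_nhds
  have hιy : ContDiffAt ℝ ∞ ι y := hι.contDiffAt (hU.mem_nhds (hU'U hy))
  have hev : ∀ᶠ x in nhds (ι y), ContDiffAt ℝ ∞ r x ∧ r x ∈ U' ∧ x ∈ S := by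
    refine hr.and (Filter.Eventually.and ?_ (hS.eventually_mem (hUS (hU'U hy))))
    refine hr.self_of_nhds.continuousAt.eventually_mem ?_
    rw [hry]
    exact hU'.mem_nhds hy
  obtain ⟨S', hS'sub, hS'o, hyS'⟩ := mem_nhds_iff.1 hev
  -- The imaginary part is extended as J of the extended real part, not as the lift of B. This gives
  -- a section of L_J also away from the image of ι; on the image it is the lift of B.
  have hext : ∀ A : F → GT F, ContDiffOn ℝ ∞ A U' →
      ContDiffOn ℝ ∞ (fun x => τ (r x) (A (r x))) S' ∧
      ContDiffOn ℝ ∞ (fun x => J x (τ (r x) (A (r x)))) S' := by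
    intro A hA
    have hx : ∀ x ∈ S', ContDiffAt ℝ ∞ (fun x => τ (r x) (A (r x))) x := by
      intro x hx
      obtain ⟨hrx, hxU, hxS⟩ := hS'sub hx
      have e1 : ContDiffAt ℝ ∞ (fun x => τ (r x)) x := (hτ _ (hU'U hxU)).comp x hrx
      have e2 : ContDiffAt ℝ ∞ (fun x => A (r x)) x :=
        (hA.contDiffAt (hU'.mem_nhds hxU)).comp x hrx
      exact e1.clm_apply e2
    refine ⟨fun x h => (hx x h).contDiffWithinAt, fun x h => ?_⟩
    exact ((hJ.contDiffAt (hS.mem_nhds (hS'sub h).2.2)).clm_apply (hx x h)).contDiffWithinAt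
  have hmem : ∀ A : F → GT F, ∀ x ∈ S', cx (τ (r x) (A (r x))) (J x (τ (r x) (A (r x)))) ∈
      eigenL (J x : GT E →ₗ[ℝ] GT E) := fun A x hx =>
    (cx_mem_eigenL_of_sq (fun C => hsq x (hS'sub hx).2.2 C) _ _).2 rfl
  have key := hinv S' hS'o (fun x hx => (hS'sub hx).2.2) _ _ _ _ (hext A₁ hA₁).1 (hext A₁ hA₁).2
    (hext A₂ hA₂).1 (hext A₂ hA₂).2 (hmem A₁) (hmem A₂) (ι y) hyS'
  have hyS : ι y ∈ S := hUS (hU'U hy)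
  have key' := (cx_mem_eigenL_of_sq (fun C => hsq _ hyS C) _ _).1 key
  have hU'n : ∀ᶠ z in nhds y, z ∈ U' := hU'.mem_nhds hy
  have relA : ∀ A : F → GT F, ∀ᶠ z in nhds y,
      IsRelated (fderiv ℝ ι z) (A z) ((fun x => τ (r x) (A (r x))) (ι z)) := by
    intro A
    filter_upwards [hrι, hU'n] with z hz hzU
    simp only [hz]
    exact hτrel z (hU'U hzU) _
  have relB : ∀ A B : F → GT F, (∀ z ∈ U', JM z (A z) = B z) → ∀ᶠ z in nhds y,
      IsRelated (fderiv ℝ ι z) (B z) ((fun x => J x (τ (r x) (A (r x)))) (ι z)) := by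
    intro A B hAB
    filter_upwards [hrι, hU'n] with z hz hzU
    simp only [hz]
    rw [hτJ z (hU'U hzU), hAB z hzU]
    exact hτrel z (hU'U hzU) _
  have d : ∀ A : F → GT F, ContDiffOn ℝ ∞ A U' → DifferentiableAt ℝ A y := fun A hA =>
    (hA.contDiffAt (hU'.mem_nhds hy)).differentiableAt (by simp)
  have d' : ∀ A : E → GT E, ContDiffOn ℝ ∞ A S' → DifferentiableAt ℝ A (ι y) := fun A hA =>
    (hA.contDiffAt (hS'o.mem_nhds hyS')).differentiableAt (by simp)
  have dA₁ := d' _ (hext A₁ hA₁).1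
  have dB₁ := d' _ (hext A₁ hA₁).2
  have dA₂ := d' _ (hext A₂ hA₂).1
  have dB₂ := d' _ (hext A₂ hA₂).2
  have rAA := courant_related hιy (d _ hA₁) (d _ hA₂) dA₁ dA₂ (relA A₁) (relA A₂)
  have rBB := courant_related hιy (d _ hB₁) (d _ hB₂) dB₁ dB₂ (relB A₁ B₁ h1) (relB A₂ B₂ h2)
  have rAB := courant_related hιy (d _ hA₁) (d _ hB₂) dA₁ dB₂ (relA A₁) (relB A₂ B₂ h2)
  have rBA := courant_related hιy (d _ hB₁) (d _ hA₂) dB₁ dA₂ (relB A₁ B₁ h1) (relA A₂)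
  exact (cx_mem_eigenL_of_sq (fun C => hsqM y (hU'U hy) C) _ _).2
    ((hind y (hU'U hy)).apply_related (rAA.sub rBB) (rAB.add rBA) key')

end

/-! ### The local theorem for immersions between vector spaces. -/

section

variable {E : Type*} [NormedAddCommGroup E] [NormedSpace ℝ E] [FiniteDimensional ℝ E]
  {F : Type*} [NormedAddCommGroup F] [NormedSpace ℝ F] [FiniteDimensional ℝ F]

/-- Smoothness and integrability of the endomorphism fields induced on the source of an immersion
between vector spaces. -/
theorem smooth_involutive_of_induces {ι : F → E} {U : Set F}
    {S : Set E} (hU : IsOpen U) (hS : IsOpen S) (hι : ContDiffOn ℝ ∞ ι U) (hUS : Set.MapsTo ι U S)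
    (hinj : ∀ z ∈ U, Function.Injective (fderiv ℝ ι z))
    {J₀ J₁ : E → GT E →L[ℝ] GT E} {K₀ K₁ : F → GT F →L[ℝ] GT F}
    (hJ₀ : ContDiffOn ℝ ∞ J₀ S) (hJ₁ : ContDiffOn ℝ ∞ J₁ S)
    (hpair : ∀ x ∈ S, IsKaehlerPair (J₀ x : GT E →ₗ[ℝ] GT E) (J₁ x : GT E →ₗ[ℝ] GT E))
    (hN : ∀ z ∈ U, (conormal (fderiv ℝ ι z)).map (J₀ (ι z) : GT E →ₗ[ℝ] GT E) =
      conormal (fderiv ℝ ι z))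
    (hK₀ : ∀ z ∈ U, Induces (fderiv ℝ ι z) (J₀ (ι z) : GT E →ₗ[ℝ] GT E)
      (K₀ z : GT F →ₗ[ℝ] GT F))
    (hK₁ : ∀ z ∈ U, Induces (fderiv ℝ ι z) (J₁ (ι z) : GT E →ₗ[ℝ] GT E)
      (K₁ z : GT F →ₗ[ℝ] GT F))
    (hinv₀ : IsInvolutiveOn (fun x => eigenL (J₀ x : GT E →ₗ[ℝ] GT E)) S)
    (hinv₁ : IsInvolutiveOn (fun x => eigenL (J₁ x : GT E →ₗ[ℝ] GT E)) S) :
    (ContDiffOn ℝ ∞ K₀ U ∧ IsInvolutiveOn (fun z => eigenL (K₀ z : GT F →ₗ[ℝ] GT F)) U) ∧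
    (ContDiffOn ℝ ∞ K₁ U ∧ IsInvolutiveOn (fun z => eigenL (K₁ z : GT F →ₗ[ℝ] GT F)) U) := by
  let τ : F → GT F →L[ℝ] GT E := fun z => liftCLM (fderiv ℝ ι z) (J₀ (ι z)) (J₁ (ι z))
  have hlift : ∀ z ∈ U, IsLift (fderiv ℝ ι z) (J₀ (ι z) : GT E →ₗ[ℝ] GT E)
      (J₁ (ι z) : GT E →ₗ[ℝ] GT E) (τ z : GT F →ₗ[ℝ] GT E) := fun z hz =>
    isLift_liftCLM (hinj z hz) (hpair _ (hUS hz))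
  have hιz : ∀ z ∈ U, ContDiffAt ℝ ∞ ι z := fun z hz => hι.contDiffAt (hU.mem_nhds hz)
  have hJ₀z : ∀ z ∈ U, ContDiffAt ℝ ∞ (fun z => J₀ (ι z)) z := fun z hz =>
    (hJ₀.contDiffAt (hS.mem_nhds (hUS hz))).comp z (hιz z hz)
  have hJ₁z : ∀ z ∈ U, ContDiffAt ℝ ∞ (fun z => J₁ (ι z)) z := fun z hz =>
    (hJ₁.contDiffAt (hS.mem_nhds (hUS hz))).comp z (hιz z hz)
  have hτ : ∀ z ∈ U, ContDiffAt ℝ ∞ τ z := fun z hz =>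
    contDiffAt_liftCLM ((hιz z hz).fderiv_right (m := ∞) (by simp)) (hJ₀z z hz) (hJ₁z z hz)
      (hinj z hz) (hpair _ (hUS hz))
  have hrel : ∀ z ∈ U, ∀ A, IsRelated (fderiv ℝ ι z) A (τ z A) := fun z hz A =>
    ⟨(hlift z hz).fst A, (hlift z hz).snd A⟩
  -- No regularity of K₀ and K₁ is assumed: being induced pointwise already forces them to
  -- correspond to J₀ and J₁ under the smooth lift τ.
  have hcomm₀ : ∀ z ∈ U, ∀ A, J₀ (ι z) (τ z A) = τ z (K₀ z A) := fun z hz A =>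
    (hK₀ z hz).comm_lift (hlift z hz)
      ((hlift z hz).map_mem_range₀ (hpair _ (hUS hz)) (hN z hz)) A
  have hcomm₁ : ∀ z ∈ U, ∀ A, J₁ (ι z) (τ z A) = τ z (K₁ z A) := fun z hz A =>
    (hK₁ z hz).comm_lift (hlift z hz)
      ((hlift z hz).map_mem_range₁ (hpair _ (hUS hz)) (hN z hz)) A
  have main : ∀ (J : E → GT E →L[ℝ] GT E) (K : F → GT F →L[ℝ] GT F), ContDiffOn ℝ ∞ J S →
      (∀ x ∈ S, ∀ A, J x (J x A) = -A) →
      (∀ z ∈ U, ∀ A, J (ι z) (τ z A) = τ z (K z A)) →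
      (∀ z ∈ U, Induces (fderiv ℝ ι z) (J (ι z) : GT E →ₗ[ℝ] GT E) (K z : GT F →ₗ[ℝ] GT F)) →
      IsInvolutiveOn (fun x => eigenL (J x : GT E →ₗ[ℝ] GT E)) S →
      ContDiffOn ℝ ∞ K U ∧ IsInvolutiveOn (fun z => eigenL (K z : GT F →ₗ[ℝ] GT F)) U := by
    intro J K hJ hsq hcomm hind hinv
    refine ⟨fun z hz => ContDiffAt.contDiffWithinAt ?_,
      isInvolutiveOn_induced hU hS hι hUS hinj hJ hτ hsq ?_ hrel hcomm hind hinv⟩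
    · refine contDiffAt_of_lift (hτ z hz)
        ((hJ.contDiffAt (hS.mem_nhds (hUS hz))).comp z (hιz z hz)) ?_ ?_
      · filter_upwards [hU.mem_nhds hz] with z' hz' A B
        exact (hlift z' hz').pairing_eq A B
      · filter_upwards [hU.mem_nhds hz] with z' hz'
        exact hcomm z' hz'
    · intro z hz A
      apply (hlift z hz).injective
      change τ z (K z (K z A)) = τ z (-A)
      rw [← hcomm z hz, ← hcomm z hz, hsq _ (hUS hz), map_neg]
  exact ⟨main J₀ K₀ hJ₀ (fun x hx => (hpair x hx).sq₀) hcomm₀ hK₀ hinv₀,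
    main J₁ K₁ hJ₁ (fun x hx => (hpair x hx).sq₁) hcomm₁ hK₁ hinv₁⟩

/-- Inside multilinear maps the pullback is a continuous multilinear expression in copies of T. In
finite dimension a linear left inverse of the inclusion of alternating maps brings smoothness back.
-/
theorem contDiffAt_compContinuousLinearMap {G : Type*} [NormedAddCommGroup G] [NormedSpace ℝ G]
    {k : ℕ} {n : WithTop ℕ∞} {θ : G → E [⋀^Fin k]→L[ℝ] ℂ} {T : G → F →L[ℝ] E} {y : G}
    (hθ : ContDiffAt ℝ n θ y) (hT : ContDiffAt ℝ n T y) :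
    ContDiffAt ℝ n (fun z => (θ z).compContinuousLinearMap (T z)) y := by
  let L : (F [⋀^Fin k]→L[ℝ] ℂ) →L[ℝ] ContinuousMultilinearMap ℝ (fun _ : Fin k => F) ℂ :=
    ContinuousAlternatingMap.toContinuousMultilinearMapCLM ℝ
  have hL : Function.Injective L := ContinuousAlternatingMap.toContinuousMultilinearMap_injective
  have : FiniteDimensional ℝ (ContinuousMultilinearMap ℝ (fun _ : Fin k => F) ℂ) :=
    Module.Finite.of_injective
      (ContinuousMultilinearMap.toMultilinearMapLinear :
        ContinuousMultilinearMap ℝ (fun _ : Fin k => F) ℂ →ₗ[ℝ] _)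
      ContinuousMultilinearMap.toMultilinearMap_injective
  obtain ⟨R, hR⟩ := LinearMap.exists_leftInverse_of_injective L.toLinearMap
    (LinearMap.ker_eq_bot.2 hL)
  let R' : ContinuousMultilinearMap ℝ (fun _ : Fin k => F) ℂ →L[ℝ] (F [⋀^Fin k]→L[ℝ] ℂ) :=
    LinearMap.toContinuousLinearMap R
  have h1 : ContDiffAt ℝ n (fun z =>
      ContinuousMultilinearMap.compContinuousLinearMapContinuousMultilinear ℝ
        (fun _ : Fin k => F) (fun _ : Fin k => E) ℂ (fun _ => T z)) y :=
    (ContinuousMultilinearMap.contDiff _).contDiffAt.comp y (contDiffAt_pi.2 fun _ => hT)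
  have h2 : ContDiffAt ℝ n (fun z => (ContinuousAlternatingMap.toContinuousMultilinearMapCLM ℝ :
      (E [⋀^Fin k]→L[ℝ] ℂ) →L[ℝ] _) (θ z)) y :=
    (ContinuousLinearMap.contDiff _).contDiffAt.comp y hθ
  have h3 := R'.contDiff.contDiffAt.comp y (h1.clm_apply h2)
  refine h3.congr_of_eventuallyEq (Filter.Eventually.of_forall fun z => ?_)
  exact (LinearMap.congr_fun hR ((θ z).compContinuousLinearMap (T z))).symm

end

/-! ### Transport of the linear structures by isomorphisms. -/

section Conjugation

variable {V W V' W' : Type*}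
  [AddCommGroup V] [Module ℝ V] [TopologicalSpace V] [IsTopologicalAddGroup V] [ContinuousSMul ℝ V]
  [AddCommGroup W] [Module ℝ W] [TopologicalSpace W] [IsTopologicalAddGroup W] [ContinuousSMul ℝ W]
  [AddCommGroup V'] [Module ℝ V'] [TopologicalSpace V'] [IsTopologicalAddGroup V']
  [ContinuousSMul ℝ V']
  [AddCommGroup W'] [Module ℝ W'] [TopologicalSpace W'] [IsTopologicalAddGroup W']
  [ContinuousSMul ℝ W']

/-- The map `W ⊕ W* → W' ⊕ W'*` given by an isomorphism `χ` with inverse `χ'`. -/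
def mapGT (χ : W →L[ℝ] W') (χ' : W' →L[ℝ] W) : GT W →ₗ[ℝ] GT W' where
  toFun A := (χ A.1, A.2.comp χ')
  map_add' A B := by simp
  map_smul' c A := by simp

theorem mapGT_apply (χ : W →L[ℝ] W') (χ' : W' →L[ℝ] W) (A : GT W) :
    mapGT χ χ' A = (χ A.1, A.2.comp χ') := rfl

/-- The endomorphism of `W' ⊕ W'*` corresponding to an endomorphism of `W ⊕ W*`. -/
def conjGT (χ : W →L[ℝ] W') (χ' : W' →L[ℝ] W) (J : GT W →ₗ[ℝ] GT W) : GT W' →ₗ[ℝ] GT W' :=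
  mapGT χ χ' ∘ₗ J ∘ₗ mapGT χ' χ

theorem conjGT_apply (χ : W →L[ℝ] W') (χ' : W' →L[ℝ] W) (J : GT W →ₗ[ℝ] GT W) (A : GT W') :
    conjGT χ χ' J A = mapGT χ χ' (J (mapGT χ' χ A)) := rfl

variable {χ : W →L[ℝ] W'} {χ' : W' →L[ℝ] W} (h : χ.comp χ' = ContinuousLinearMap.id ℝ W')
  (h' : χ'.comp χ = ContinuousLinearMap.id ℝ W)

include h in
theorem mapGT_mapGT (A : GT W') : mapGT χ χ' (mapGT χ' χ A) = A := by
  refine Prod.ext (DFunLike.congr_fun h A.1) ?_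
  change (A.2.comp χ).comp χ' = A.2
  rw [ContinuousLinearMap.comp_assoc, h, ContinuousLinearMap.comp_id]

include h' in
theorem pairing_mapGT (A B : GT W) : pairing (mapGT χ χ' A) (mapGT χ χ' B) = pairing A B := by
  have e : ∀ w, χ' (χ w) = w := DFunLike.congr_fun h'
  simp [mapGT_apply, pairing, e]

include h h'

theorem IsKaehlerPair.conjGT {J₀ J₁ : GT W →ₗ[ℝ] GT W} (hJ : IsKaehlerPair J₀ J₁) :
    IsKaehlerPair (conjGT χ χ' J₀) (conjGT χ χ' J₁) := by
  constructor
  · intro A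
    rw [conjGT_apply, conjGT_apply, mapGT_mapGT h', hJ.sq₀, map_neg, mapGT_mapGT h]
  · intro A
    rw [conjGT_apply, conjGT_apply, mapGT_mapGT h', hJ.sq₁, map_neg, mapGT_mapGT h]
  · intro A B
    rw [conjGT_apply, conjGT_apply, pairing_mapGT h', hJ.orth₀, pairing_mapGT h]
  · intro A B
    rw [conjGT_apply, conjGT_apply, pairing_mapGT h', hJ.orth₁, pairing_mapGT h]
  · intro A
    simp only [conjGT_apply]
    rw [mapGT_mapGT h', mapGT_mapGT h', hJ.comm]
  · intro A hA
    rw [conjGT_apply, conjGT_apply, mapGT_mapGT h', ← map_neg]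
    have h0 : mapGT χ' χ A ≠ 0 := fun h0 => hA (by
      have := congrArg (mapGT χ χ') h0
      rwa [mapGT_mapGT h, map_zero] at this)
    have := hJ.pos _ h0
    rwa [← pairing_mapGT h', mapGT_mapGT h] at this

variable {φ : V →L[ℝ] V'} {φ' : V' →L[ℝ] V} (k : φ.comp φ' = ContinuousLinearMap.id ℝ V')
  (k' : φ'.comp φ = ContinuousLinearMap.id ℝ V)
include k k'

theorem conormal_conjGT {f : V →L[ℝ] W} {J : GT W →ₗ[ℝ] GT W}
    (hN : (conormal f).map J = conormal f) :
    (conormal (χ.comp (f.comp φ'))).map (conjGT χ χ' J) = conormal (χ.comp (f.comp φ')) := by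
  have e1 : ∀ A : GT W, A ∈ conormal f → mapGT χ χ' A ∈ conormal (χ.comp (f.comp φ')) := by
    intro A hA
    refine ⟨by simp [mapGT_apply, hA.1], ?_⟩
    change (A.2.comp χ').comp (χ.comp (f.comp φ')) = 0
    rw [ContinuousLinearMap.comp_assoc, ← ContinuousLinearMap.comp_assoc χ', h',
      ContinuousLinearMap.id_comp, ← ContinuousLinearMap.comp_assoc, hA.2,
      ContinuousLinearMap.zero_comp]
  have e2 : ∀ A : GT W', A ∈ conormal (χ.comp (f.comp φ')) → mapGT χ' χ A ∈ conormal f := by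
    intro A hA
    refine ⟨by simp [mapGT_apply, hA.1], ?_⟩
    change (A.2.comp χ).comp f = 0
    have h1 := congrArg (fun g => g.comp φ) hA.2
    simp only [ContinuousLinearMap.comp_assoc, ContinuousLinearMap.zero_comp] at h1
    rw [k', ContinuousLinearMap.comp_id] at h1
    exact h1
  apply le_antisymm
  · rintro _ ⟨A, hA, rfl⟩
    rw [conjGT_apply]
    refine e1 _ ?_
    rw [← hN]
    exact ⟨_, e2 A hA, rfl⟩
  · intro A hA
    have h1 := e2 A hA
    rw [← hN] at h1
    obtain ⟨B, hB, hBA⟩ := h1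
    refine ⟨mapGT χ χ' B, e1 B hB, ?_⟩
    rw [conjGT_apply, mapGT_mapGT h', hBA, mapGT_mapGT h]

theorem Induces.conjGT {f : V →L[ℝ] W} {J : GT W →ₗ[ℝ] GT W} {JM : GT V →ₗ[ℝ] GT V}
    (hJ : Induces f J JM) :
    Induces (χ.comp (f.comp φ')) (conjGT χ χ' J) (conjGT φ φ' JM) := by
  have e1 : ∀ a : V' × (W' →L[ℝ] ℝ), mapGT χ' χ (includeGT (χ.comp (f.comp φ')) a) =
      includeGT f (φ' a.1, a.2.comp χ) := fun a =>
    Prod.ext (DFunLike.congr_fun h' _) rfl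
  have e2 : ∀ a : V' × (W' →L[ℝ] ℝ), mapGT φ φ' (restrictGT f (φ' a.1, a.2.comp χ)) =
      restrictGT (χ.comp (f.comp φ')) a := fun a =>
    Prod.ext (DFunLike.congr_fun k _) rfl
  intro a b hab
  have h1 := congrArg (mapGT χ' χ) hab
  rw [conjGT_apply, mapGT_mapGT h', e1, e1] at h1
  have h2 := congrArg (mapGT φ φ') (hJ _ _ h1)
  rw [e2] at h2
  rw [← h2, conjGT_apply, ← e2 a, mapGT_mapGT k']

end Conjugation

/-! ### Coordinate expressions in charts. -/

section Charts

variable {E : Type*} [NormedAddCommGroup E] [NormedSpace ℝ E]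
  {X : Type*} [TopologicalSpace X] [ChartedSpace E X]
  {F : Type*} [NormedAddCommGroup F] [NormedSpace ℝ F]
  {M : Type*} [TopologicalSpace M] [ChartedSpace F M]

instance finiteDimensional_tangentSpace [FiniteDimensional ℝ E] (x : X) :
    FiniteDimensional ℝ (TangentSpace 𝓘(ℝ, E) x) :=
  inferInstanceAs (FiniteDimensional ℝ E)

instance t2Space_tangentSpace (x : X) : T2Space (TangentSpace 𝓘(ℝ, E) x) :=
  inferInstanceAs (T2Space E)

theorem chartDeriv_comp_chartSymmDeriv [IsManifold 𝓘(ℝ, E) ∞ X] {e : OpenPartialHomeomorph X E}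
    (he : e ∈ atlas E X) {q : E} (hq : q ∈ e.target) :
    (chartDeriv e (e.symm q)).comp (chartSymmDeriv e q) = ContinuousLinearMap.id ℝ E := by
  have : IsManifold 𝓘(ℝ, E) 1 X := IsManifold.of_le (n := ∞) (by simp)
  have h := (mdifferentiable_of_mem_atlas (I := 𝓘(ℝ, E)) he).comp_symm_deriv hq
  exact h

theorem chartSymmDeriv_comp_chartDeriv [IsManifold 𝓘(ℝ, E) ∞ X] {e : OpenPartialHomeomorph X E}
    (he : e ∈ atlas E X) {q : E} (hq : q ∈ e.target) :
    (chartSymmDeriv e q).comp (chartDeriv e (e.symm q)) =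
      ContinuousLinearMap.id ℝ (TangentSpace 𝓘(ℝ, E) (e.symm q)) := by
  have : IsManifold 𝓘(ℝ, E) 1 X := IsManifold.of_le (n := ∞) (by simp)
  have h := (mdifferentiable_of_mem_atlas (I := 𝓘(ℝ, E)) he).symm_comp_deriv
    (e.map_target hq)
  have hq' : e (e.symm q) = q := e.right_inv hq
  rw [hq'] at h
  exact h

theorem EndField.coe_inChart (J : EndField E X) (e : OpenPartialHomeomorph X E) (y : E) :
    (J.inChart e y : GT E →ₗ[ℝ] GT E) =
      conjGT (chartDeriv e (e.symm y)) (chartSymmDeriv e y)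
        (J (e.symm y) : GT (TangentSpace 𝓘(ℝ, E) (e.symm y)) →ₗ[ℝ] _) := rfl

/-- The coordinate expression of a map between manifolds. -/
def coordExpr (i : M → X) (e : OpenPartialHomeomorph M F) (e' : OpenPartialHomeomorph X E) :
    F → E := e' ∘ i ∘ e.symm

/-- The domain of the coordinate expression of a map between manifolds. -/
def coordDomain (i : M → X) (e : OpenPartialHomeomorph M F) (e' : OpenPartialHomeomorph X E) :
    Set F := e.target ∩ e.symm ⁻¹' (i ⁻¹' e'.source)

theorem isOpen_coordDomain {i : M → X} (hi : Continuous i) (e : OpenPartialHomeomorph M F)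
    (e' : OpenPartialHomeomorph X E) : IsOpen (coordDomain i e e') :=
  e.isOpen_inter_preimage_symm (e'.open_source.preimage hi)

theorem coordExpr_mapsTo (i : M → X) (e : OpenPartialHomeomorph M F)
    (e' : OpenPartialHomeomorph X E) :
    Set.MapsTo (coordExpr i e e') (coordDomain i e e') e'.target :=
  fun _ hz => e'.map_source hz.2

theorem chartSymm_coordExpr {i : M → X} {e : OpenPartialHomeomorph M F}
    {e' : OpenPartialHomeomorph X E} {z : F} (hz : z ∈ coordDomain i e e') :
    i (e.symm z) = e'.symm (coordExpr i e e' z) :=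
  (e'.left_inv hz.2).symm

variable [IsManifold 𝓘(ℝ, E) ∞ X] [IsManifold 𝓘(ℝ, F) ∞ M]
  {i : M → X} (hi : ContMDiff 𝓘(ℝ, F) 𝓘(ℝ, E) ∞ i)
  {e : OpenPartialHomeomorph M F} (he : e ∈ atlas F M)
  {e' : OpenPartialHomeomorph X E} (he' : e' ∈ atlas E X)
include hi he he'

theorem contDiffOn_coordExpr : ContDiffOn ℝ ∞ (coordExpr i e e') (coordDomain i e e') := by
  rw [← contMDiffOn_iff_contDiffOn]
  have h1 : ContMDiffOn 𝓘(ℝ, F) 𝓘(ℝ, F) ∞ e.symm e.target :=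
    contMDiffOn_symm_of_mem_maximalAtlas (IsManifold.subset_maximalAtlas he)
  have h2 : ContMDiffOn 𝓘(ℝ, E) 𝓘(ℝ, E) ∞ e' e'.source :=
    contMDiffOn_of_mem_maximalAtlas (IsManifold.subset_maximalAtlas he')
  exact h2.comp (hi.comp_contMDiffOn (h1.mono Set.inter_subset_left)) fun z hz => hz.2

theorem fderiv_coordExpr {z : F} (hz : z ∈ coordDomain i e e') :
    fderiv ℝ (coordExpr i e e') z = (chartDeriv e' (i (e.symm z))).comp
      ((mfderiv 𝓘(ℝ, F) 𝓘(ℝ, E) i (e.symm z)).comp (chartSymmDeriv e z)) := by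
  have : IsManifold 𝓘(ℝ, E) 1 X := IsManifold.of_le (n := ∞) (by simp)
  have : IsManifold 𝓘(ℝ, F) 1 M := IsManifold.of_le (n := ∞) (by simp)
  have d1 := (mdifferentiable_of_mem_atlas (I := 𝓘(ℝ, F)) he).mdifferentiableAt_symm hz.1
  have d2 := (mdifferentiable_of_mem_atlas (I := 𝓘(ℝ, E)) he').mdifferentiableAt hz.2
  have d3 : MDifferentiableAt 𝓘(ℝ, F) 𝓘(ℝ, E) i (e.symm z) :=
    (hi.mdifferentiable (by simp)) _
  have h1 := (d2.hasMFDerivAt.comp (e.symm z) d3.hasMFDerivAt).comp z d1.hasMFDerivAt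
  rw [← mfderiv_eq_fderiv]
  exact h1.mfderiv

omit hi

/-- The point x plays the role of i (e.symm z). Its equality with e'.symm q is a separate hypothesis
so that it can be substituted, since the tangent spaces depend on the point. -/
theorem induces_inChart {J : EndField E X} {JM : EndField F M} {z : F} (hz : z ∈ e.target) {q : E}
    (hq : q ∈ e'.target) {x : X} (hx : x = e'.symm q)
    {f : TangentSpace 𝓘(ℝ, F) (e.symm z) →L[ℝ] TangentSpace 𝓘(ℝ, E) x}
    (h : Induces f (J x : GT (TangentSpace 𝓘(ℝ, E) x) →ₗ[ℝ] _)
      (JM (e.symm z) : GT (TangentSpace 𝓘(ℝ, F) (e.symm z)) →ₗ[ℝ] _)) :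
    Induces ((chartDeriv e' x).comp (f.comp (chartSymmDeriv e z)))
      (J.inChart e' q : GT E →ₗ[ℝ] GT E) (JM.inChart e z : GT F →ₗ[ℝ] GT F) := by
  subst hx
  rw [EndField.coe_inChart, EndField.coe_inChart]
  exact h.conjGT (chartDeriv_comp_chartSymmDeriv he' hq) (chartSymmDeriv_comp_chartDeriv he' hq)
    (chartDeriv_comp_chartSymmDeriv he hz) (chartSymmDeriv_comp_chartDeriv he hz)

theorem conormal_inChart {J : EndField E X} {z : F} (hz : z ∈ e.target) {q : E}
    (hq : q ∈ e'.target) {x : X} (hx : x = e'.symm q)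
    {f : TangentSpace 𝓘(ℝ, F) (e.symm z) →L[ℝ] TangentSpace 𝓘(ℝ, E) x}
    (h : (conormal f).map (J x : GT (TangentSpace 𝓘(ℝ, E) x) →ₗ[ℝ] _) = conormal f) :
    (conormal ((chartDeriv e' x).comp (f.comp (chartSymmDeriv e z)))).map
      (J.inChart e' q : GT E →ₗ[ℝ] GT E) =
      conormal ((chartDeriv e' x).comp (f.comp (chartSymmDeriv e z))) := by
  subst hx
  rw [EndField.coe_inChart]
  exact conormal_conjGT (chartDeriv_comp_chartSymmDeriv he' hq)
    (chartSymmDeriv_comp_chartDeriv he' hq)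
    (chartDeriv_comp_chartSymmDeriv he hz) (chartSymmDeriv_comp_chartDeriv he hz) h

theorem injective_inChart {z : F} (hz : z ∈ e.target) {q : E}
    (hq : q ∈ e'.target) {x : X} (hx : x = e'.symm q)
    {f : TangentSpace 𝓘(ℝ, F) (e.symm z) →L[ℝ] TangentSpace 𝓘(ℝ, E) x}
    (h : Function.Injective f) :
    Function.Injective ((chartDeriv e' x).comp (f.comp (chartSymmDeriv e z))) := by
  subst hx
  have h1 : Function.Injective (chartDeriv e' (e'.symm q)) :=
    Function.LeftInverse.injective (g := chartSymmDeriv e' q)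
      (DFunLike.congr_fun (chartSymmDeriv_comp_chartDeriv he' hq))
  have h2 : Function.Injective (chartSymmDeriv e z) :=
    Function.LeftInverse.injective (g := chartDeriv e (e.symm z))
      (DFunLike.congr_fun (chartDeriv_comp_chartSymmDeriv he hz))
  exact h1.comp (h.comp h2)

omit he in
theorem form_inChart (ψ : FormField E X) {z : F} {q : E}
    (hq : q ∈ e'.target) {x : X} (hx : x = e'.symm q)
    (f : TangentSpace 𝓘(ℝ, F) (e.symm z) →L[ℝ] TangentSpace 𝓘(ℝ, E) x) (k : ℕ) :
    ((ψ x k).compContinuousLinearMap f).compContinuousLinearMap (chartSymmDeriv e z) =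
      (ψ.inChart e' k q).compContinuousLinearMap
        ((chartDeriv e' x).comp (f.comp (chartSymmDeriv e z))) := by
  subst hx
  ext v
  have h1 : ∀ w, chartSymmDeriv e' q (chartDeriv e' (e'.symm q) w) = w :=
    DFunLike.congr_fun (chartSymmDeriv_comp_chartDeriv he' hq)
  simp only [FormField.inChart, ContinuousAlternatingMap.compContinuousLinearMap_apply]
  congr 1
  funext j
  exact (h1 _).symm

include hi in
theorem pullback_inChart (ψ : FormField E X) {z : F} (hz : z ∈ coordDomain i e e') (k : ℕ) :
    (ψ.pullback i : FormField F M).inChart e k z =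
      (ψ.inChart e' k (coordExpr i e e' z)).compContinuousLinearMap
        (fderiv ℝ (coordExpr i e e') z) := by
  rw [fderiv_coordExpr hi he he' hz]
  exact form_inChart he' ψ (coordExpr_mapsTo i e e' hz) (chartSymm_coordExpr hz) _ k

end Charts

/-! ### The complete reduction at a point. -/

section Pointwise

variable {V W : Type*}
  [AddCommGroup V] [Module ℝ V] [TopologicalSpace V] [IsTopologicalAddGroup V] [ContinuousSMul ℝ V]
  [AddCommGroup W] [Module ℝ W] [TopologicalSpace W] [IsTopologicalAddGroup W] [ContinuousSMul ℝ W]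
  [T2Space W] [FiniteDimensional ℝ W] [T2Space V] [FiniteDimensional ℝ V]

theorem exists_reduction_spinor {f : V →L[ℝ] W} (hf : Function.Injective f)
    {J₀ J₁ : GT W →ₗ[ℝ] GT W} (h : IsKaehlerPair J₀ J₁) (hN : (conormal f).map J₀ = conormal f)
    {φ : MixedForm W} (hφ : φ ≠ 0) (hker : eigenL J₁ = spinorKer φ) :
    ∃ K₀ K₁ : GT V →L[ℝ] GT V,
      Induces f J₀ (K₀ : GT V →ₗ[ℝ] GT V) ∧ Induces f J₁ (K₁ : GT V →ₗ[ℝ] GT V) ∧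
      IsKaehlerPair (K₀ : GT V →ₗ[ℝ] GT V) (K₁ : GT V →ₗ[ℝ] GT V) ∧
      eigenL (K₀ : GT V →ₗ[ℝ] GT V) = restrictSubspace f (eigenL J₀) ∧
      eigenL (K₁ : GT V →ₗ[ℝ] GT V) = spinorKer (pullForm f φ) ∧ pullForm f φ ≠ 0 := by
  obtain ⟨τ, K₀, K₁, hτ, c₀, c₁, h₀, h₁, hK⟩ := exists_reduction hf h hN
  have hne := pullForm_ne_zero h hN hφ hker
  refine ⟨LinearMap.toContinuousLinearMap K₀, LinearMap.toContinuousLinearMap K₁, ?_⟩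
  rw [LinearMap.coe_toContinuousLinearMap, LinearMap.coe_toContinuousLinearMap]
  exact ⟨h₀, h₁, hK, eigenL_eq_restrictSubspace h₀ hτ c₀ h.sq₀ hK.sq₀,
    spinorKer_pullForm hker hne (eigenL_eq_restrictSubspace h₁ hτ c₁ h.sq₁ hK.sq₁)
      hK.sq₁ hK.orth₁, hne⟩

end Pointwise

/-! ### Globalization on manifolds. -/

section Main

variable {E : Type*} [NormedAddCommGroup E] [NormedSpace ℝ E] [FiniteDimensional ℝ E]
  {X : Type*} [TopologicalSpace X] [ChartedSpace E X] [IsManifold 𝓘(ℝ, E) ∞ X]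
  {F : Type*} [NormedAddCommGroup F] [NormedSpace ℝ F] [FiniteDimensional ℝ F]
  {M : Type*} [TopologicalSpace M] [ChartedSpace F M] [IsManifold 𝓘(ℝ, F) ∞ M]

theorem mem_coordDomain_chartAt (i : M → X) {e : OpenPartialHomeomorph M F} {y : F}
    (hy : y ∈ e.target) : y ∈ coordDomain i e (chartAt E (i (e.symm y))) :=
  ⟨hy, mem_chart_source E _⟩

theorem FormField.IsSmooth.pullback {ψ : FormField E X} (hψ : ψ.IsSmooth) {i : M → X}
    (hi : ContMDiff 𝓘(ℝ, F) 𝓘(ℝ, E) ∞ i) : (ψ.pullback i : FormField F M).IsSmooth := by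
  intro e he k y hy
  set e' := chartAt E (i (e.symm y))
  have he' : e' ∈ atlas E X := chart_mem_atlas E _
  have hyU := mem_coordDomain_chartAt (E := E) i hy
  have hU := isOpen_coordDomain hi.continuous e e'
  have hι := (contDiffOn_coordExpr hi he he').contDiffAt (hU.mem_nhds hyU)
  have h1 : ContDiffAt ℝ ∞ (fun z => ψ.inChart e' k (coordExpr i e e' z)) y :=
    ((hψ e' he' k).contDiffAt (e'.open_target.mem_nhds (coordExpr_mapsTo i e e' hyU))).comp y hι
  refine ((contDiffAt_compContinuousLinearMap h1
    (hι.fderiv_right (m := ∞) (by simp))).congr_of_eventuallyEq ?_).contDiffWithinAt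
  filter_upwards [hU.mem_nhds hyU] with z hz
  exact pullback_inChart hi he he' ψ hz k

theorem FormField.IsClosed.pullback {ψ : FormField E X} (hψ : ψ.IsSmooth) (hc : ψ.IsClosed)
    {i : M → X} (hi : ContMDiff 𝓘(ℝ, F) 𝓘(ℝ, E) ∞ i) :
    (ψ.pullback i : FormField F M).IsClosed := by
  intro e he k y hy
  set e' := chartAt E (i (e.symm y))
  have he' : e' ∈ atlas E X := chart_mem_atlas E _
  have hyU := mem_coordDomain_chartAt (E := E) i hy
  have hU := isOpen_coordDomain hi.continuous e e'
  have hι := (contDiffOn_coordExpr hi he he').contDiffAt (hU.mem_nhds hyU)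
  have hyt := coordExpr_mapsTo i e e' hyU
  have h1 : DifferentiableAt ℝ (ψ.inChart e' k) (coordExpr i e e' y) :=
    ((hψ e' he' k).contDiffAt (e'.open_target.mem_nhds hyt)).differentiableAt (by simp)
  have h2 : (ψ.pullback i : FormField F M).inChart e k =ᶠ[nhds y] fun z =>
      (ψ.inChart e' k (coordExpr i e e' z)).compContinuousLinearMap
        (fderiv ℝ (coordExpr i e e') z) := by
    filter_upwards [hU.mem_nhds hyU] with z hz
    exact pullback_inChart hi he he' ψ hz k
  rw [h2.extDeriv_eq, extDeriv_pullback h1 hι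
    (by rw [minSmoothness_of_isRCLikeNormedField]; exact WithTop.coe_le_coe.2 le_top),
    hc e' he' k _ hyt]
  ext v
  simp

theorem IsGenKaehler.isKaehlerPair {J₀ J₁ : EndField E X} (h : IsGenKaehler J₀ J₁) (x : X) :
    IsKaehlerPair (J₀ x : GT (TangentSpace 𝓘(ℝ, E) x) →ₗ[ℝ] GT (TangentSpace 𝓘(ℝ, E) x))
      (J₁ x : GT (TangentSpace 𝓘(ℝ, E) x) →ₗ[ℝ] GT (TangentSpace 𝓘(ℝ, E) x)) :=
  ⟨h.left.sq x, h.right.sq x, h.left.orthogonal x, h.right.orthogonal x, h.comm x, h.pos x⟩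

theorem IsGenKaehler.isKaehlerPair_inChart {J₀ J₁ : EndField E X} (h : IsGenKaehler J₀ J₁)
    {e : OpenPartialHomeomorph X E} (he : e ∈ atlas E X) {q : E} (hq : q ∈ e.target) :
    IsKaehlerPair (J₀.inChart e q : GT E →ₗ[ℝ] GT E) (J₁.inChart e q : GT E →ₗ[ℝ] GT E) := by
  rw [EndField.coe_inChart, EndField.coe_inChart]
  exact (h.isKaehlerPair _).conjGT (chartDeriv_comp_chartSymmDeriv he hq)
    (chartSymmDeriv_comp_chartDeriv he hq)

/-- Endomorphism fields that are pointwise induced by a generalized Kähler structure form a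
generalized Kähler structure. -/
theorem IsGenKaehler.of_induces {J₀ J₁ : EndField E X} (h : IsGenKaehler J₀ J₁) {i : M → X}
    (hi : ContMDiff 𝓘(ℝ, F) 𝓘(ℝ, E) ∞ i)
    (himm : ∀ p : M, Function.Injective (mfderiv 𝓘(ℝ, F) 𝓘(ℝ, E) i p))
    (hN : HasInvariantConormal (F := F) i J₀) {K₀ K₁ : EndField F M}
    (h₀ : ∀ p, Induces (mfderiv 𝓘(ℝ, F) 𝓘(ℝ, E) i p)
      (J₀ (i p) : GT (TangentSpace 𝓘(ℝ, E) (i p)) →ₗ[ℝ] _)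
      (K₀ p : GT (TangentSpace 𝓘(ℝ, F) p) →ₗ[ℝ] _))
    (h₁ : ∀ p, Induces (mfderiv 𝓘(ℝ, F) 𝓘(ℝ, E) i p)
      (J₁ (i p) : GT (TangentSpace 𝓘(ℝ, E) (i p)) →ₗ[ℝ] _)
      (K₁ p : GT (TangentSpace 𝓘(ℝ, F) p) →ₗ[ℝ] _))
    (hK : ∀ p, IsKaehlerPair (K₀ p : GT (TangentSpace 𝓘(ℝ, F) p) →ₗ[ℝ] _)
      (K₁ p : GT (TangentSpace 𝓘(ℝ, F) p) →ₗ[ℝ] _)) :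
    IsGenKaehler K₀ K₁ := by
  -- A chart of M need not map into a single chart of X, so smoothness and involutivity are first
  -- proved near each point, in the chart of X at its image.
  have local_main : ∀ e ∈ atlas F M, ∀ y ∈ e.target, ∃ U : Set F, IsOpen U ∧ y ∈ U ∧
      ((ContDiffOn ℝ ∞ (K₀.inChart e) U ∧
        IsInvolutiveOn (fun z => eigenL (K₀.inChart e z : GT F →ₗ[ℝ] GT F)) U) ∧
      (ContDiffOn ℝ ∞ (K₁.inChart e) U ∧
        IsInvolutiveOn (fun z => eigenL (K₁.inChart e z : GT F →ₗ[ℝ] GT F)) U)) := by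
    intro e he y hy
    set e' := chartAt E (i (e.symm y))
    have he' : e' ∈ atlas E X := chart_mem_atlas E _
    have hU := isOpen_coordDomain hi.continuous e e'
    have hmaps := coordExpr_mapsTo i e e'
    refine ⟨coordDomain i e e', hU, mem_coordDomain_chartAt i hy,
      smooth_involutive_of_induces hU e'.open_target (contDiffOn_coordExpr hi he he') hmaps
        (J₀ := J₀.inChart e') (J₁ := J₁.inChart e') (fun z hz => ?_) (h.left.smooth e' he')
        (h.right.smooth e' he') (fun x hx => h.isKaehlerPair_inChart he' hx) (fun z hz => ?_)
        (fun z hz => ?_) (fun z hz => ?_) (h.left.integrable e' he') (h.right.integrable e' he')⟩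
    all_goals rw [fderiv_coordExpr hi he he' hz]
    · exact injective_inChart he he' hz.1 (hmaps hz) (chartSymm_coordExpr hz) (himm _)
    · exact conormal_inChart he he' hz.1 (hmaps hz) (chartSymm_coordExpr hz) (hN _)
    · exact induces_inChart he he' hz.1 (hmaps hz) (chartSymm_coordExpr hz) (h₀ _)
    · exact induces_inChart he he' hz.1 (hmaps hz) (chartSymm_coordExpr hz) (h₁ _)
  constructor
  · refine ⟨⟨fun e he y hy => ?_, fun p => (hK p).sq₀, fun p => (hK p).orth₀⟩,
      fun e he => isInvolutiveOn_of_local fun y hy => ?_⟩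
    · obtain ⟨U, hU, hyU, h, -⟩ := local_main e he y hy
      exact (h.1.contDiffAt (hU.mem_nhds hyU)).contDiffWithinAt
    · obtain ⟨U, hU, hyU, h, -⟩ := local_main e he y hy
      exact ⟨U, hU, hyU, h.2⟩
  · refine ⟨⟨fun e he y hy => ?_, fun p => (hK p).sq₁, fun p => (hK p).orth₁⟩,
      fun e he => isInvolutiveOn_of_local fun y hy => ?_⟩
    · obtain ⟨U, hU, hyU, -, h⟩ := local_main e he y hy
      exact (h.1.contDiffAt (hU.mem_nhds hyU)).contDiffWithinAt
    · obtain ⟨U, hU, hyU, -, h⟩ := local_main e he y hy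
      exact ⟨U, hU, hyU, h.2⟩
  · exact fun p => (hK p).comm
  · exact fun p => (hK p).pos

/-- The fields are chosen point by point with no regularity; `IsGenKaehler.of_induces` recovers
smoothness and integrability. -/
theorem exists_induced_fields {J₀ J₁ : EndField E X} (h : IsGenKaehler J₀ J₁) {ψ : FormField E X}
    (hψ : ∀ x, ψ.at x ≠ 0) (hker : IsStructureOfSpinor J₁ ψ) {i : M → X}
    (himm : ∀ p : M, Function.Injective (mfderiv 𝓘(ℝ, F) 𝓘(ℝ, E) i p))
    (hN : HasInvariantConormal (F := F) i J₀) :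
    ∃ K₀ K₁ : EndField F M,
      (∀ p, Induces (mfderiv 𝓘(ℝ, F) 𝓘(ℝ, E) i p)
        (J₀ (i p) : GT (TangentSpace 𝓘(ℝ, E) (i p)) →ₗ[ℝ] _)
        (K₀ p : GT (TangentSpace 𝓘(ℝ, F) p) →ₗ[ℝ] _)) ∧
      (∀ p, Induces (mfderiv 𝓘(ℝ, F) 𝓘(ℝ, E) i p)
        (J₁ (i p) : GT (TangentSpace 𝓘(ℝ, E) (i p)) →ₗ[ℝ] _)
        (K₁ p : GT (TangentSpace 𝓘(ℝ, F) p) →ₗ[ℝ] _)) ∧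
      (∀ p, IsKaehlerPair (K₀ p : GT (TangentSpace 𝓘(ℝ, F) p) →ₗ[ℝ] _)
        (K₁ p : GT (TangentSpace 𝓘(ℝ, F) p) →ₗ[ℝ] _)) ∧
      IsInducedStructure i J₀ K₀ ∧
      IsStructureOfSpinor K₁ (ψ.pullback i) ∧
      ∀ p, (ψ.pullback i : FormField F M).at p ≠ 0 := by
  choose K₀ K₁ h₀ h₁ hK hind hker' hne using fun p : M =>
    exists_reduction_spinor (himm p) (h.isKaehlerPair (i p)) (hN p) (hψ (i p)) (hker (i p))
  exact ⟨K₀, K₁, h₀, h₁, hK, hind, hker', hne⟩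

end Main

end GenKaehler

end

theorem theorem1p14
    {E : Type*} [NormedAddCommGroup E] [NormedSpace ℝ E] [FiniteDimensional ℝ E]
    {X : Type*} [TopologicalSpace X] [ChartedSpace E X] [IsManifold 𝓘(ℝ, E) ∞ X]
    {F : Type*} [NormedAddCommGroup F] [NormedSpace ℝ F] [FiniteDimensional ℝ F]
    {M : Type*} [TopologicalSpace M] [ChartedSpace F M] [IsManifold 𝓘(ℝ, F) ∞ M]
    (J₀ : EndField E X) (ψ : FormField E X) (hX : IsGenKaehlerOnePureSpinor J₀ ψ)
    (i : M → X) (hi : ContMDiff 𝓘(ℝ, F) 𝓘(ℝ, E) ∞ i)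
    (himm : ∀ p : M, Function.Injective (mfderiv 𝓘(ℝ, F) 𝓘(ℝ, E) i p))
    (hN : HasInvariantConormal (F := F) i J₀) :
    (∀ p : M, (ψ.pullback i : FormField F M).at p ≠ 0) ∧
    IsClosedNondegeneratePureSpinor (ψ.pullback i : FormField F M) ∧
    (∃! JM : EndField F M, IsInducedStructure i J₀ JM) ∧
    ∀ JM : EndField F M, IsInducedStructure i J₀ JM →
      IsGenKaehlerOnePureSpinor JM (ψ.pullback i) := by
  obtain ⟨J₁, hker, hJ⟩ := hX.genKaehler
  obtain ⟨K₀, K₁, h₀, h₁, hK, hind, hker', hne⟩ :=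
    exists_induced_fields hJ (fun x => (hX.spinor.pure x).1) hker himm hN
  have hspinor : IsClosedNondegeneratePureSpinor (ψ.pullback i : FormField F M) := by
    refine ⟨hX.spinor.smooth.pullback hi, hX.spinor.closed.pullback hX.spinor.smooth hi,
      fun p => ⟨hne p, ?_⟩, fun p => ?_⟩
    · have h1 := two_mul_finrank_eigenL (hK p).sq₁
      rw [finrank_GT, hker' p] at h1
      exact Nat.eq_of_mul_eq_mul_left two_pos h1
    · have h1 := isCompl_eigenL_conj (hK p).sq₁
      rw [hker' p] at h1
      exact h1
  have huniq : ∀ JM : EndField F M, IsInducedStructure i J₀ JM → JM = K₀ := by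
    intro JM hJM
    funext p
    exact ContinuousLinearMap.coe_injective
      (eq_of_eigenL_eq (hK p).sq₀ ((hJM p).trans (hind p).symm))
  have hKK := hJ.of_induces hi himm hN h₀ h₁ hK
  refine ⟨hne, hspinor, ⟨K₀, hind, huniq⟩, fun JM hJM => ?_⟩
  rw [huniq JM hJM]
  exact ⟨hKK.left, hspinor, K₁, hker', hKK⟩
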